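/- Let $\Phi$ be a Euclidean domain, that is, an integral domain with a norm $|\cdot|:\Phi\setminus\{0\}\to\mathbb Z_{\ge 0}$ such that (E1) $|ab|\ge|a|$ for all nonzero $a,b$, with equality only if $b$ is invertible, and (E2) for all $a,b\in\Phi$ with $b\ne 0$ there are $q,r\in\Phi$ with $a=bq+r$ and either $r=0$ or $|r|<|b|$. Put $e=|1|$. Let $L_3(\Phi)=L_\Phi\langle x_1,x_2,x_3\rangle$ be the free Lie algebra over $\Phi$ with free generators $x_1,x_2,x_3$, and write $\varphi=(f_1,f_2,f_3)$ for the automorphism with $\varphi(x_i)=f_i$. An automorphism is elementary if for some $i$ it sends $x_i$ to $\alpha x_i+f$, with $\alpha\in\Phi$ invertible and $f$ in the subalgebra generated by the $x_j$, $j\ne i$, and fixes $x_j$ for all $j\ne i$; it is tame if it lies in the subgroup generated by the elementary automorphisms. Order the nonassociative words in $x_1,x_2,x_3$ linearly as follows: $x_1>x_2>x_3$; a shorter word is smaller than a longer one; and words $u=u_1u_2$, $v=v_1v_2$ of the same length $\ge 2$ satisfy $u<v$ if and only if $u_1<v_1$, or $u_1=v_1$ and $u_2<v_2$. Let $V$ be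 the set of Shirshov's regular words, defined recursively: the letters are regular, and $uv$ is regular if and only if $u,v$ are regular, $u>v$, and $u_2\le v$ whenever $u=u_1u_2$. By Shirshov's theorem $V$ is a basis of the free $\Phi$-module $L_3(\Phi)$. For $0\ne f\in L_3(\Phi)$ let $lm(f)\in V$ be the greatest word that occurs in the expansion of $f$ in this basis with a nonzero coefficient, and let $lc(f)\in\Phi$ be its coefficient. For an automorphism $\varphi=(f_1,f_2,f_3)$ put $$D(\varphi)=\bigl(u,w,s,\ |lc(f_1)|+|lc(f_2)|+|lc(f_3)|\bigr)\in V^3\times\mathbb Z_{\ge0},$$ where $u\ge w\ge s$ are the words $lm(f_1),lm(f_2),lm(f_3)$ (with repetitions) in decreasing order, and order $V^3\times\mathbb Z_{\ge0}$ lexicographically by $\prec$. An automorphism $\theta=(f_1,f_2,f_3)$ is called elementarily $D$-reducible if there is an automorphism $\psi$ with $D(\psi)\prec D(\theta)$ whose triple is obtained from $(f_1,f_2,f_3)$ by replacing a single $f_i$ with $\alpha f_i+g$, where $\alpha\in\Phi$ is invertible and $g$ lies in the subalgebra generated by the $f_j$, $j\ne i$. Then every tame automorphism $\varphi$ of $L_3(\Phi)$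 with $D(\varphi)\succ(x_1,x_2,x_3,3e)$ is elementarily $D$-reducible. -/

import Mathlib

noncomputable section

namespace FreeLieThree

/-- The free Lie algebra `L₃(Φ) = L_Φ⟨x₁, x₂, x₃⟩`; the generators `x₁, x₂, x₃` are indexed by
`0, 1, 2 : Fin 3`. -/
abbrev L (Φ : Type*) [CommRing Φ] : Type _ := FreeLieAlgebra Φ (Fin 3)

/-- The free generators. -/
abbrev x (Φ : Type*) [CommRing Φ] (i : Fin 3) : L Φ := FreeLieAlgebra.of Φ i

section Automorphisms

variable (Φ : Type*) [CommRing Φ]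

/-- Automorphisms of `L₃(Φ)`. -/
abbrev Aut : Type _ := L Φ ≃ₗ⁅Φ⁆ L Φ

/-- The automorphisms form a group under composition, `(φ * ψ) f = φ (ψ f)`. -/
instance : Group (Aut Φ) where
  mul φ ψ := ψ.trans φ
  one := LieEquiv.refl
  inv φ := φ.symm
  mul_assoc _ _ _ := rfl
  one_mul _ := rfl
  mul_one _ := rfl
  inv_mul_cancel φ := by
    apply LieEquiv.ext
    intro f
    exact φ.symm_apply_apply f

variable {Φ}

/-- The triple `(f₁, f₂, f₃)` of images of the generators which denotes the automorphism `φ`. -/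
def components (φ : Aut Φ) : Fin 3 → L Φ := fun i => φ (x Φ i)

/-- `δ` is elementary: for some `i`, `δ(xᵢ) = α xᵢ + f` with `α` invertible and `f` in the
subalgebra generated by the other generators, and `δ(xⱼ) = xⱼ` for `j ≠ i`. -/
def IsElementary (δ : Aut Φ) : Prop :=
  ∃ (i : Fin 3) (α : Φ) (f : L Φ), IsUnit α ∧
    f ∈ LieSubalgebra.lieSpan Φ (L Φ) {g | ∃ j, j ≠ i ∧ g = x Φ j} ∧
    δ (x Φ i) = α • x Φ i + f ∧ ∀ j, j ≠ i → δ (x Φ j) = x Φ j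

variable (Φ) in
/-- The subgroup of tame automorphisms, generated by the elementary ones. -/
def tameSubgroup : Subgroup (Aut Φ) := Subgroup.closure {δ | IsElementary δ}

/-- `ElementaryTransformation f g`: the system `g = (g₁, g₂, g₃)` arises from `f = (f₁, f₂, f₃)`
by replacing one element `fᵢ` by `α fᵢ + h`, with `α` invertible and `h` in the subalgebra
generated by the `fⱼ`, `j ≠ i`. -/
def ElementaryTransformation (f g : Fin 3 → L Φ) : Prop :=
  ∃ (i : Fin 3) (α : Φ) (h : L Φ), IsUnit α ∧
    h ∈ LieSubalgebra.lieSpan Φ (L Φ) {k | ∃ j, j ≠ i ∧ k = f j} ∧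
    g = Function.update f i (α • f i + h)

end Automorphisms

section Words

/-- Nonassociative words in the alphabet `{x₁, x₂, x₃}`. -/
abbrev Word : Type := FreeMagma (Fin 3)

/-- The strict order on nonassociative words: `x₁ > x₂ > x₃`, a shorter word is smaller, and
words of equal length `≥ 2` are compared by their first factors, then by their second factors. -/
def Word.Lt : Word → Word → Prop
  | .of i, .of j => j < i
  | .of _, .mul _ _ => True
  | .mul _ _, .of _ => False
  | .mul u₁ u₂, .mul v₁ v₂ =>
      (u₁ * u₂).length < (v₁ * v₂).length ∨
        ((u₁ * u₂).length = (v₁ * v₂).length ∧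
          (Word.Lt u₁ v₁ ∨ (u₁ = v₁ ∧ Word.Lt u₂ v₂)))

theorem Word.lt_irrefl (u : Word) : ¬ Word.Lt u u := by
  induction u with
  | of i => simp [Word.Lt]
  | mul a b iha ihb =>
    intro h
    change Word.Lt (.mul a b) (.mul a b) at h
    simp only [Word.Lt] at h
    grind

theorem Word.lt_trans (u v w : Word) : Word.Lt u v → Word.Lt v w → Word.Lt u w := by
  induction u generalizing v w with
  | of i =>
    cases v <;> cases w <;> simp only [Word.Lt] <;> grind
  | mul a b iha ihb =>
    cases v <;> cases w <;> simp only [Word.Lt] <;> grind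

theorem Word.lt_trichotomy (u v : Word) : Word.Lt u v ∨ u = v ∨ Word.Lt v u := by
  induction u generalizing v with
  | of i =>
    cases v with
    | of j =>
      rcases _root_.lt_trichotomy i j with h | h | h
      · exact Or.inr (Or.inr h)
      · exact Or.inr (Or.inl (congrArg FreeMagma.of h))
      · exact Or.inl h
    | mul c d => simp [Word.Lt]
  | mul a b iha ihb =>
    change Word.Lt (.mul a b) v ∨ FreeMagma.mul a b = v ∨ Word.Lt v (.mul a b)
    cases v with
    | of j => simp [Word.Lt]
    | mul c d =>
      simp only [Word.Lt]
      have h1 := iha c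
      have h2 := ihb d
      have h3 : a = c → b = d → FreeMagma.mul a b = FreeMagma.mul c d := by
        rintro rfl rfl
        rfl
      grind

instance : IsStrictTotalOrder Word Word.Lt where
  irrefl := Word.lt_irrefl
  trans := Word.lt_trans
  trichotomous u v h₁ h₂ := by
    have := Word.lt_trichotomy u v
    tauto

open Classical in
/-- The linear order on nonassociative words with strict part `Word.Lt`. -/
instance : LinearOrder Word := linearOrderOfSTO Word.Lt

/-- Regular nonassociative words (in the sense of Shirshov, 1953): the letters, and the words `u v`
with `u, v` regular, `u > v`, and `u₂ ≤ v` in case `u = u₁ u₂`. -/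
def IsRegularWord : Word → Prop
  | .of _ => True
  | .mul u v => IsRegularWord u ∧ IsRegularWord v ∧ v < u ∧ ∀ u₁ u₂ : Word, u = u₁ * u₂ → u₂ ≤ v

/-- The set `V` of regular words, with the order induced from all nonassociative words. -/
abbrev RegularWord : Type := {w : Word // IsRegularWord w}

/-- The letters as regular words. -/
def letter (i : Fin 3) : RegularWord := ⟨FreeMagma.of i, trivial⟩

end Words

section Index

variable {Φ : Type*} [CommRing Φ]

variable (Φ) in
/-- The element of `L₃(Φ)` represented by a nonassociative word. -/
def wordElement : Word → L Φ
  | .of i => x Φ i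
  | .mul u v => ⁅wordElement u, wordElement v⁆

/-- The coefficients of `f` in the basis `V` of the free `Φ`-module `L₃(Φ)`: the finitely supported
family `c` with `f = ∑ v, c v • v`. It exists and is unique by Shirshov's theorem that the regular
words form a basis. -/
def regularCoeffs (f : L Φ) : RegularWord →₀ Φ :=
  Function.invFun
    (fun c : RegularWord →₀ Φ => c.sum fun v a => a • wordElement Φ v.1) f

open Classical in
/-- The leading word `lm(f)`: the greatest regular word occurring in `f` with a nonzero
coefficient (an irrelevant default value for `f = 0`). -/
def lm (f : L Φ) : RegularWord :=
  if h : (regularCoeffs f).support.Nonempty then (regularCoeffs f).support.max' h else letter 2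

/-- The leading coefficient `lc(f)`: the coefficient of the leading word. -/
def lc (f : L Φ) : Φ := regularCoeffs f (lm f)

/-- `N` is a Euclidean norm on `Φ`; only its values at nonzero elements matter. -/
structure IsEuclideanNorm (N : Φ → ℕ) : Prop where
  le_mul : ∀ a b : Φ, a ≠ 0 → b ≠ 0 → N a ≤ N (a * b)
  isUnit_of_eq : ∀ a b : Φ, a ≠ 0 → b ≠ 0 → N (a * b) = N a → IsUnit b
  exists_div : ∀ a b : Φ, b ≠ 0 → ∃ q r : Φ, a = b * q + r ∧ (r = 0 ∨ N r < N b)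

/-- `V³ × ℤ₊` with the lexicographic order. -/
abbrev IndexType : Type := RegularWord ×ₗ RegularWord ×ₗ RegularWord ×ₗ ℕ

/-- Constructor for `V³ × ℤ₊`. -/
def mkIndex (u w s : RegularWord) (n : ℕ) : IndexType :=
  toLex (u, toLex (w, toLex (s, n)))

/-- `(u, w, s, n)` where `u ≥ w ≥ s` are the words `a, b, c` in decreasing order
(maximum, median, minimum). -/
def sortedIndex (a b c : RegularWord) (n : ℕ) : IndexType :=
  mkIndex (max a (max b c)) (max (min a b) (min (max a b) c)) (min a (min b c)) n

/-- The index `D(φ) = (u, w, s, |lc(f₁)| + |lc(f₂)| + |lc(f₃)|)` of `φ = (f₁, f₂, f₃)`, where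
`{u, w, s} = {lm(f₁), lm(f₂), lm(f₃)}` and `u ≥ w ≥ s`. -/
def D (N : Φ → ℕ) (φ : Aut Φ) : IndexType :=
  sortedIndex (lm (components φ 0)) (lm (components φ 1)) (lm (components φ 2))
    (N (lc (components φ 0)) + N (lc (components φ 1)) + N (lc (components φ 2)))

/-- `θ` is elementarily `D`-reducible: some automorphism `ψ` obtained from `θ` by a single
elementary transformation of the components has `D(ψ) ≺ D(θ)`. -/
def ElementarilyDReducible (N : Φ → ℕ) (θ : Aut Φ) : Prop :=
  ∃ ψ : Aut Φ, ElementaryTransformation (components θ) (components ψ) ∧ D N ψ < D N θ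

end Index

end FreeLieThree

end

/-!
Two components of a triple with the same leading word can be reduced by dividing their leading
coefficients with remainder. So the question is how two elementary transformations of the same
triple interact, and the answer is a peak reduction. Call a triple *simple* if a chain of elementary
transformations with decreasing index leads from it to an index at most `(x₁, x₂, x₃, 3e)`.
Elementary transformations preserve simplicity (`Simple.elementaryTransformation`), by induction on
the index; as the triple of the generators is simple, so are the components of every tame
automorphism, and a simple triple of greater index is reducible by definition.

In the induction step a triple `f` has a simple reduction `g₁`, which changes `fᵢ`, and a second
transform `g₂` of index at most that of `f`, in which `fⱼ` is changed. Everything rests on a fact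
about subalgebras with two generators (`exists_linear_pair`): if `a` and `b` are linearly
independent, an element of the subalgebra generated by `a` and `b` whose leading word does not
exceed those of both generators is a linear combination of `a` and `b`. If
`lm fⱼ < lm fᵢ ≠ lm fₖ`, it follows that the change of `fⱼ` does not involve `fᵢ`, so that the two
transformations commute (`exists_commuting`). In the remaining cases with `i ≠ j` two of the leading
words are equal and both transformations are linear. Then `g₁` and `g₂` are bases of the lattice
spanned by `f`; the Euclidean algorithm takes each of them to a basis with distinct leading words,
and two such bases differ by a permutation and a triangular matrix, hence are connected by
transformations at the least index that occurs in the lattice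
(`PreservedBelow.of_span_eq_of_strictAnti`).

For the fact on two generators, the free Lie algebra is embedded into the free associative algebra.
Every word of letters factors into a weakly increasing sequence of regular words, and such a
sequence is determined by its letters (`factorize_flatMap_foliage`). Since the increasing products
of regular words span the free associative algebra (`prodSpan_le_sortedSpan`), and a surjective
endomorphism of a finite module is injective, they form a basis (`pbwMap_injective`); so do the
regular words in the free Lie algebra. Multiplication by a nonzero Lie element raises the number of
factors in this basis by one, so a Lie element is a left multiple of another one only if it is a
scalar multiple (`exists_smul_eq_of_toU_mul`).

Hence two Lie elements with distinct leading words have right independent leading parts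
(`eq_zero_of_toU_mul_add`) and no cancellation occurs in noncommutative polynomials in them
(`weight_le_deg_evalPair`); in particular a nonlinear Lie polynomial has greater degree than both
elements.
-/

noncomputable section

namespace FreeLieThree

attribute [local instance] LieRing.ofAssociativeRing

/-! ### The order on nonassociative words -/

theorem Word.length_mul (u v : Word) : (u * v).length = u.length + v.length := rfl

theorem Word.length_of (i : Fin 3) : FreeMagma.length (FreeMagma.of i) = 1 := rfl

theorem Word.lt_of_length_lt {u v : Word} (h : u.length < v.length) : u < v := by
  change Word.Lt u v
  cases u with
  | of i =>
    cases v with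
    | of j => simp at h
    | mul c d => simp [Word.Lt]
  | mul a b =>
    cases v with
    | of j =>
      have h1 := FreeMagma.length_pos a
      have h2 := FreeMagma.length_pos b
      change a.length + b.length < 1 at h
      omega
    | mul c d =>
      simp only [Word.Lt]
      exact Or.inl h

theorem Word.length_le_of_le {u v : Word} (h : u ≤ v) : u.length ≤ v.length := by
  by_contra! hlt
  exact absurd (Word.lt_of_length_lt hlt) (not_lt.mpr h)

theorem Word.finite_length_le (n : ℕ) : {w : Word | w.length ≤ n}.Finite := by
  induction n with
  | zero =>
    refine Set.Finite.subset Set.finite_empty fun w hw => ?_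
    have := FreeMagma.length_pos w
    change w.length ≤ 0 at hw
    omega
  | succ n ih =>
    refine ((Set.finite_range (FreeMagma.of : Fin 3 → Word)).union
      (Set.Finite.image2 (fun a b : Word => a * b) ih ih)).subset fun w hw => ?_
    cases w with
    | of i => exact Or.inl ⟨i, rfl⟩
    | mul a b =>
      have h1 := FreeMagma.length_pos a
      have h2 := FreeMagma.length_pos b
      change a.length + b.length ≤ n + 1 at hw
      exact Or.inr ⟨a, show a.length ≤ n by omega, b, show b.length ≤ n by omega, rfl⟩

theorem Word.finite_Iio (w : Word) : (Set.Iio w).Finite :=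
  (Word.finite_length_le w.length).subset fun _ hv => Word.length_le_of_le (le_of_lt hv)

instance : WellFoundedLT Word := by
  refine StrictMono.wellFoundedLT (f := fun w : Word => (Set.Iio w).ncard) fun u v huv => ?_
  refine Set.ncard_lt_ncard ?_ (Word.finite_Iio v)
  exact ⟨fun x hx => lt_trans hx huv, fun hsub => lt_irrefl u (hsub huv)⟩

instance : WellFoundedLT RegularWord :=
  ⟨InvImage.wf (fun v : RegularWord => v.1) (wellFounded_lt (α := Word))⟩

theorem letter_two_le (v : RegularWord) : letter 2 ≤ v := by
  change (FreeMagma.of 2 : Word) ≤ v.1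
  rcases v with ⟨w, hw⟩
  cases w with
  | of i =>
    rcases lt_or_eq_of_le (Fin.le_last i) with h | h
    · exact le_of_lt (show Word.Lt _ _ from by simpa [Word.Lt] using h)
    · exact le_of_eq (congrArg FreeMagma.of h.symm)
  | mul a b => exact le_of_lt (show Word.Lt _ _ from by simp [Word.Lt])

theorem isRegularWord_mul {u v : Word} : IsRegularWord (u * v) ↔
    IsRegularWord u ∧ IsRegularWord v ∧ v < u ∧ ∀ u₁ u₂ : Word, u = u₁ * u₂ → u₂ ≤ v :=
  Iff.rfl

/-! ### Regular words span the free Lie algebra -/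

section Span

variable (Φ : Type*) [CommRing Φ]

theorem wordElement_mul (u v : Word) :
    wordElement Φ (u * v) = ⁅wordElement Φ u, wordElement Φ v⁆ := rfl

/-- The span of the regular words of length `n`. -/
def regularSpan (n : ℕ) : Submodule Φ (L Φ) :=
  Submodule.span Φ (wordElement Φ '' {w | IsRegularWord w ∧ w.length = n})

variable {Φ}

theorem wordElement_mem_regularSpan {w : Word} (hw : IsRegularWord w) {n : ℕ}
    (hn : w.length = n) : wordElement Φ w ∈ regularSpan Φ n :=
  Submodule.subset_span ⟨w, ⟨hw, hn⟩, rfl⟩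

/-- The collecting process: the bracket of two regular words is a linear combination of regular
words. If `u = u₁ u₂` with `u₂ > v`, the Jacobi identity replaces `[u, v]` by `[[u₁, v], u₂]` and
`[u₁, [u₂, v]]`, whose smaller entries exceed `v`. The induction is on the total length and then
on the number of words above the smaller entry. -/
theorem lie_wordElement_mem_regularSpan {u v : Word} (hu : IsRegularWord u)
    (hv : IsRegularWord v) :
    ⁅wordElement Φ u, wordElement Φ v⁆ ∈ regularSpan Φ (u.length + v.length) := by
  suffices H : ∀ n k : ℕ, ∀ u v : Word, IsRegularWord u → IsRegularWord v →
      u.length + v.length = n → {w : Word | w.length ≤ n ∧ min u v < w}.ncard = k →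
      ⁅wordElement Φ u, wordElement Φ v⁆ ∈ regularSpan Φ n from H _ _ u v hu hv rfl rfl
  clear hu hv u v
  intro n
  induction n using Nat.strong_induction_on with
  | _ n ihn =>
  intro k
  induction k using Nat.strong_induction_on with
  | _ k ihk =>
  have ordered : ∀ u v : Word, IsRegularWord u → IsRegularWord v → v < u →
      u.length + v.length = n → {w : Word | w.length ≤ n ∧ min u v < w}.ncard = k →
      ⁅wordElement Φ u, wordElement Φ v⁆ ∈ regularSpan Φ n := by
    intro u v hu hv hvu hn hk
    by_cases hreg : ∀ u₁ u₂ : Word, u = u₁ * u₂ → u₂ ≤ v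
    · exact wordElement_mem_regularSpan (w := u * v) ⟨hu, hv, hvu, hreg⟩ hn
    · push Not at hreg
      obtain ⟨u₁, u₂, rfl, hlt⟩ := hreg
      obtain ⟨hu₁, hu₂, hu₁₂, -⟩ := isRegularWord_mul.1 hu
      have hl₁ := FreeMagma.length_pos u₁
      have hl₂ := FreeMagma.length_pos u₂
      have hlv := FreeMagma.length_pos v
      rw [Word.length_mul] at hn
      have step : ∀ p q : Word, IsRegularWord p → IsRegularWord q → p.length + q.length = n →
          v < p → v < q → ⁅wordElement Φ p, wordElement Φ q⁆ ∈ regularSpan Φ n := by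
        intro p q hp hq hpq hvp hvq
        refine ihk _ ?_ p q hp hq hpq rfl
        rw [← hk, min_eq_right hvu.le]
        refine Set.ncard_lt_ncard ⟨fun w hw => ⟨hw.1, (lt_min hvp hvq).trans hw.2⟩, fun hsub => ?_⟩
          ((Word.finite_length_le n).subset fun w hw => hw.1)
        have hmem : min p q ∈ {w : Word | w.length ≤ n ∧ v < w} := by
          refine ⟨?_, lt_min hvp hvq⟩
          have := Word.length_le_of_le (min_le_left p q)
          omega
        exact lt_irrefl _ (hsub hmem).2
      rw [wordElement_mul, lie_lie]
      have h₁ : ⁅wordElement Φ u₁, ⁅wordElement Φ u₂, wordElement Φ v⁆⁆ ∈ regularSpan Φ n := by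
        have hmem := ihn (u₂.length + v.length) (by omega) _ u₂ v hu₂ hv rfl rfl
        refine Submodule.span_induction (p := fun x _ => ⁅wordElement Φ u₁, x⁆ ∈ regularSpan Φ n)
          ?_ ?_ ?_ ?_ hmem
        · rintro _ ⟨w, ⟨hw, hwl⟩, rfl⟩
          exact step _ _ hu₁ hw (by omega) (hlt.trans hu₁₂) (Word.lt_of_length_lt (by omega))
        · rw [lie_zero]; exact Submodule.zero_mem _
        · intro x y _ _ hx hy
          rw [lie_add]; exact Submodule.add_mem _ hx hy
        · intro c x _ hx
          rw [lie_smul]; exact Submodule.smul_mem _ c hx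
      have h₂ : ⁅wordElement Φ u₂, ⁅wordElement Φ u₁, wordElement Φ v⁆⁆ ∈ regularSpan Φ n := by
        have hmem := ihn (u₁.length + v.length) (by omega) _ u₁ v hu₁ hv rfl rfl
        refine Submodule.span_induction (p := fun x _ => ⁅wordElement Φ u₂, x⁆ ∈ regularSpan Φ n)
          ?_ ?_ ?_ ?_ hmem
        · rintro _ ⟨w, ⟨hw, hwl⟩, rfl⟩
          exact step _ _ hu₂ hw (by omega) hlt (Word.lt_of_length_lt (by omega))
        · rw [lie_zero]; exact Submodule.zero_mem _
        · intro x y _ _ hx hy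
          rw [lie_add]; exact Submodule.add_mem _ hx hy
        · intro c x _ hx
          rw [lie_smul]; exact Submodule.smul_mem _ c hx
      exact Submodule.sub_mem _ h₁ h₂
  intro u v hu hv hn hk
  rcases lt_trichotomy v u with h | h | h
  · exact ordered u v hu hv h hn hk
  · rw [h, lie_self]; exact Submodule.zero_mem _
  · rw [← lie_skew]
    refine Submodule.neg_mem _ (ordered v u hv hu h (by omega) ?_)
    rwa [min_comm]

/-- A Lie subalgebra containing the free generators is everything. -/
theorem lieSubalgebra_eq_top {S : LieSubalgebra Φ (L Φ)} (h : ∀ i, x Φ i ∈ S) : S = ⊤ := by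
  let F : L Φ →ₗ⁅Φ⁆ S := FreeLieAlgebra.lift Φ fun i => ⟨x Φ i, h i⟩
  have hF : S.incl.comp F = LieHom.id := by
    apply FreeLieAlgebra.hom_ext
    intro i
    simp [F, x]
  rw [eq_top_iff]
  intro f _
  have : S.incl (F f) = f := congrArg (fun G : L Φ →ₗ⁅Φ⁆ L Φ => G f) hF
  rw [← this]
  exact (F f).2

theorem span_regularWord_eq_top :
    Submodule.span Φ (Set.range fun v : RegularWord => wordElement Φ v.1) = ⊤ := by
  set S₀ := Submodule.span Φ (Set.range fun v : RegularWord => wordElement Φ v.1) with hS₀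
  have hle : ∀ n, regularSpan Φ n ≤ S₀ := fun n =>
    Submodule.span_mono (by rintro _ ⟨w, hw, rfl⟩; exact ⟨⟨w, hw.1⟩, rfl⟩)
  let S : LieSubalgebra Φ (L Φ) :=
    { S₀ with
      lie_mem' := by
        intro a b ha hb
        refine Submodule.span_induction₂ (p := fun a b _ _ => ⁅a, b⁆ ∈ S₀)
          ?_ ?_ ?_ ?_ ?_ ?_ ?_ ha hb
        · rintro _ _ ⟨u, rfl⟩ ⟨v, rfl⟩
          exact hle _ (lie_wordElement_mem_regularSpan u.2 v.2)
        · intro b _; rw [zero_lie]; exact S₀.zero_mem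
        · intro b _; rw [lie_zero]; exact S₀.zero_mem
        · intro a b c _ _ _ h₁ h₂; rw [add_lie]; exact S₀.add_mem h₁ h₂
        · intro a b c _ _ _ h₁ h₂; rw [lie_add]; exact S₀.add_mem h₁ h₂
        · intro r a b _ _ h; rw [smul_lie]; exact S₀.smul_mem r h
        · intro r a b _ _ h; rw [lie_smul]; exact S₀.smul_mem r h }
  have hS : S = ⊤ := lieSubalgebra_eq_top fun i => Submodule.subset_span ⟨letter i, rfl⟩
  rw [eq_top_iff]
  intro f _
  have : f ∈ S := hS ▸ LieSubalgebra.mem_top f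
  exact this

end Span

/-! ### Sorted products of regular words span the free associative algebra -/

section Straighten

variable (Φ : Type*) [CommRing Φ]

/-- The free associative algebra on three generators, as the algebra of the free monoid. -/
abbrev U : Type _ := MonoidAlgebra Φ (FreeMonoid (Fin 3))

/-- The homomorphism of the free Lie algebra into the free associative algebra which fixes the
generators. -/
def toU : L Φ →ₗ⁅Φ⁆ U Φ :=
  FreeLieAlgebra.lift Φ fun i => MonoidAlgebra.single (FreeMonoid.of i) 1

/-- The associative product of the elements represented by the words of a list. -/
def listProd (S : List Word) : U Φ := (S.map fun w => toU Φ (wordElement Φ w)).prod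

/-- The product of the elements represented by the regular words of a list. -/
def regProd (S : List RegularWord) : U Φ := listProd Φ (S.map (·.1))

/-- The total length of a list of words. -/
def totalLength (S : List RegularWord) : ℕ := (S.map fun v => v.1.length).sum

/-- The span of the products of at most `k` regular words of total length at most `n`. -/
def prodSpan (k n : ℕ) : Submodule Φ (U Φ) :=
  Submodule.span Φ (regProd Φ '' {S | S.length ≤ k ∧ totalLength S ≤ n})

variable {Φ}

theorem toU_x (i : Fin 3) : toU Φ (x Φ i) = MonoidAlgebra.single (FreeMonoid.of i) 1 :=
  FreeLieAlgebra.lift_of_apply _ i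

theorem toU_lie (f g : L Φ) : toU Φ ⁅f, g⁆ = toU Φ f * toU Φ g - toU Φ g * toU Φ f := by
  rw [LieHom.map_lie]; rfl

theorem listProd_append (S T : List Word) :
    listProd Φ (S ++ T) = listProd Φ S * listProd Φ T := by
  simp [listProd]

theorem regProd_append (S T : List RegularWord) :
    regProd Φ (S ++ T) = regProd Φ S * regProd Φ T := by
  simp [regProd, listProd_append]

theorem regProd_cons (v : RegularWord) (S : List RegularWord) :
    regProd Φ (v :: S) = toU Φ (wordElement Φ v.1) * regProd Φ S := by
  simp [regProd, listProd]

theorem regProd_singleton (v : RegularWord) : regProd Φ [v] = toU Φ (wordElement Φ v.1) := by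
  simp [regProd, listProd]

theorem regProd_mem_prodSpan {S : List RegularWord} {k n : ℕ} (hk : S.length ≤ k)
    (hn : totalLength S ≤ n) : regProd Φ S ∈ prodSpan Φ k n :=
  Submodule.subset_span ⟨S, ⟨hk, hn⟩, rfl⟩

theorem prodSpan_mono {k k' n n' : ℕ} (hk : k ≤ k') (hn : n ≤ n') :
    prodSpan Φ k n ≤ prodSpan Φ k' n' :=
  Submodule.span_mono (Set.image_mono fun _ hS => ⟨hS.1.trans hk, hS.2.trans hn⟩)

theorem mul_mem_prodSpan {k k' n n' : ℕ} {a b : U Φ} (ha : a ∈ prodSpan Φ k n)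
    (hb : b ∈ prodSpan Φ k' n') : a * b ∈ prodSpan Φ (k + k') (n + n') := by
  have hle : prodSpan Φ k n * prodSpan Φ k' n' ≤ prodSpan Φ (k + k') (n + n') := by
    rw [prodSpan, prodSpan, Submodule.span_mul_span, Submodule.span_le]
    rintro _ ⟨_, ⟨S, hS, rfl⟩, _, ⟨T, hT, rfl⟩, rfl⟩
    change regProd Φ S * regProd Φ T ∈ _
    rw [← regProd_append]
    obtain ⟨hS₁, hS₂⟩ := hS
    obtain ⟨hT₁, hT₂⟩ := hT
    refine regProd_mem_prodSpan ?_ ?_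
    · rw [List.length_append]; omega
    · simp only [totalLength, List.map_append, List.sum_append] at *; omega
  exact hle (Submodule.mul_mem_mul ha hb)

theorem toU_regularSpan {n : ℕ} {f : L Φ} (hf : f ∈ regularSpan Φ n) :
    toU Φ f ∈ prodSpan Φ 1 n := by
  have hle : (regularSpan Φ n).map (toU Φ : L Φ →ₗ[Φ] U Φ) ≤ prodSpan Φ 1 n := by
    rw [regularSpan, Submodule.map_span, Submodule.span_le]
    rintro _ ⟨_, ⟨w, ⟨hw, hn⟩, rfl⟩, rfl⟩
    have := regProd_mem_prodSpan (Φ := Φ) (S := [⟨w, hw⟩]) (k := 1) (n := n) (by simp)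
      (by simp [totalLength, hn])
    rwa [regProd_singleton] at this
  exact hle ⟨f, hf, rfl⟩

/-- Reordering the factors of a product of regular words changes it by products with fewer
factors. -/
theorem regProd_sub_mem_of_perm {S T : List RegularWord} (h : S.Perm T) :
    ∀ k n : ℕ, S.length ≤ k + 1 → totalLength S ≤ n →
      regProd Φ S - regProd Φ T ∈ prodSpan Φ k n := by
  induction h with
  | nil => intro k n _ _; rw [sub_self]; exact Submodule.zero_mem _
  | @cons v S T h ih =>
    intro k n hk hn
    rw [regProd_cons, regProd_cons, ← mul_sub]
    cases k with
    | zero =>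
      have hS : S = [] := by simpa using hk
      subst hS
      rw [List.nil_perm.1 h, sub_self, mul_zero]
      exact Submodule.zero_mem _
    | succ k =>
      have hn' : v.1.length + totalLength S ≤ n := by simpa [totalLength] using hn
      have h₁ := ih k (totalLength S) (by simpa using hk) le_rfl
      have h₂ := regProd_mem_prodSpan (Φ := Φ) (S := [v]) (k := 1) (n := v.1.length) (by simp)
        (by simp [totalLength])
      rw [regProd_singleton] at h₂
      exact prodSpan_mono (by omega) hn' (mul_mem_prodSpan h₂ h₁)
  | swap u v S =>
    intro k n hk hn
    rw [regProd_cons, regProd_cons, regProd_cons, regProd_cons, ← mul_assoc, ← mul_assoc,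
      ← sub_mul, ← toU_lie]
    have h₁ := toU_regularSpan (Φ := Φ) (lie_wordElement_mem_regularSpan v.2 u.2)
    have h₂ := regProd_mem_prodSpan (Φ := Φ) (S := S) le_rfl le_rfl
    simp only [List.length_cons] at hk
    simp only [totalLength, List.map_cons, List.sum_cons] at hn h₂
    exact prodSpan_mono (by omega) (by omega) (mul_mem_prodSpan h₁ h₂)
  | @trans S T R h₁ h₂ ih₁ ih₂ =>
    intro k n hk hn
    have hlen := h₁.length_eq
    have htot : totalLength S = totalLength T := (h₁.map _).sum_eq
    have := Submodule.add_mem _ (ih₁ k n hk hn) (ih₂ k n (by omega) (by omega))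
    rwa [sub_add_sub_cancel] at this

/-- The weakly increasing list of the regular words in a monomial, with multiplicities. -/
def sortedList (s : RegularWord →₀ ℕ) : List RegularWord := (Finsupp.toMultiset s).sort (· ≤ ·)

theorem sortedList_perm (S : List RegularWord) :
    S.Perm (sortedList (Multiset.toFinsupp (S : Multiset RegularWord))) := by
  rw [← Multiset.coe_eq_coe, sortedList, Multiset.sort_eq, Multiset.toFinsupp_toMultiset]

variable (Φ) in
/-- The linear map from commutative polynomials in the regular words which sends a monomial to the
associative product of its factors in increasing order. -/
def pbwMap : MvPolynomial RegularWord Φ →ₗ[Φ] U Φ :=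
  (MvPolynomial.basisMonomials RegularWord Φ).constr Φ fun s => regProd Φ (sortedList s)

theorem pbwMap_monomial (s : RegularWord →₀ ℕ) (c : Φ) :
    pbwMap Φ (MvPolynomial.monomial s c) = c • regProd Φ (sortedList s) := by
  have : MvPolynomial.monomial s c = c • MvPolynomial.basisMonomials RegularWord Φ s := by
    simp [MvPolynomial.smul_monomial]
  rw [this, map_smul, pbwMap, Module.Basis.constr_basis]

variable (Φ) in
/-- The span of the increasing products of at most `k` regular words of total length at most
`n`. -/
def sortedSpan (k n : ℕ) : Submodule Φ (U Φ) :=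
  Submodule.span Φ ((fun s => regProd Φ (sortedList s)) ''
    {s | (sortedList s).length ≤ k ∧ totalLength (sortedList s) ≤ n})

theorem prodSpan_le_sortedSpan (k n : ℕ) : prodSpan Φ k n ≤ sortedSpan Φ k n := by
  induction k with
  | zero =>
    refine Submodule.span_mono ?_
    rintro _ ⟨S, ⟨hk, hn⟩, rfl⟩
    have hS : S = [] := by simpa using hk
    subst hS
    refine ⟨0, ?_, ?_⟩ <;> simp [sortedList, totalLength]
  | succ k ih =>
    rw [prodSpan, Submodule.span_le]
    rintro _ ⟨S, ⟨hk, hn⟩, rfl⟩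
    have hperm := sortedList_perm S
    have h₁ := ih (regProd_sub_mem_of_perm (Φ := Φ) hperm k n hk hn)
    have h₂ : sortedSpan Φ k n ≤ sortedSpan Φ (k + 1) n :=
      Submodule.span_mono (Set.image_mono fun s hs => ⟨hs.1.trans k.le_succ, hs.2⟩)
    have h₃ : regProd Φ (sortedList (Multiset.toFinsupp (S : Multiset RegularWord))) ∈
        sortedSpan Φ (k + 1) n := by
      refine Submodule.subset_span ⟨_, ⟨?_, ?_⟩, rfl⟩
      · rw [← hperm.length_eq]; exact hk
      · refine le_trans (le_of_eq ?_) hn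
        exact ((hperm.map _).sum_eq).symm
    have := Submodule.add_mem _ (h₂ h₁) h₃
    rwa [sub_add_cancel] at this

theorem length_sortedList (s : RegularWord →₀ ℕ) :
    (sortedList s).length = s.sum fun _ => id := by
  rw [sortedList, Multiset.length_sort, Finsupp.card_toMultiset]

theorem sortedSpan_le_map_pbwMap {k n : ℕ} {a : U Φ} (ha : a ∈ sortedSpan Φ k n) :
    ∃ p : MvPolynomial RegularWord Φ, p.totalDegree ≤ k ∧ pbwMap Φ p = a := by
  have hle : sortedSpan Φ k n ≤
      (MvPolynomial.restrictTotalDegree RegularWord Φ k).map (pbwMap Φ) := by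
    rw [sortedSpan, Submodule.span_le]
    rintro _ ⟨s, ⟨hk, -⟩, rfl⟩
    refine ⟨MvPolynomial.monomial s 1, ?_, ?_⟩
    · simp only [SetLike.mem_coe]
      rw [MvPolynomial.mem_restrictTotalDegree]
      refine (MvPolynomial.totalDegree_monomial_le s 1).trans ?_
      rwa [← length_sortedList]
    · rw [pbwMap_monomial, one_smul]
  obtain ⟨p, hp, rfl⟩ := hle ha
  exact ⟨p, (MvPolynomial.mem_restrictTotalDegree _ _ p).1 hp, rfl⟩

end Straighten

/-! ### Factorization of letter words into increasing sequences of regular words -/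

/-- The word of letters obtained from a nonassociative word by dropping the brackets. -/
def foliage : Word → List (Fin 3)
  | .of i => [i]
  | .mul u v => foliage u ++ foliage v

/-- Inserting the word `t` in front of an increasing sequence: while `t` is greater than the first
term of the sequence, it absorbs this term as a right factor. -/
def absorb (t : Word) : List Word → List Word
  | [] => [t]
  | s :: S => if s < t then absorb (t * s) S else t :: s :: S

/-- The factorization of a word of letters into a weakly increasing sequence of regular words,
computed from right to left. -/
def factorize (w : List (Fin 3)) : List Word :=
  w.foldr (fun i S => absorb (FreeMagma.of i) S) []

theorem foliage_mul (u v : Word) : foliage (u * v) = foliage u ++ foliage v := rfl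

theorem absorb_of_head_le {t : Word} {S : List Word} (h : ∀ s ∈ S, t ≤ s) :
    absorb t S = t :: S := by
  cases S with
  | nil => rfl
  | cons s S => rw [absorb, if_neg (not_lt.2 (h s (by simp)))]

/-- If `t` may be put in front of the factorization `S` of `w` (it need not be at most the first
term of `S`, but its right factor is), then the letters of `t` are reassembled to `t` before `S` is
touched. -/
theorem factorize_foliage_append {t : Word} (ht : IsRegularWord t) :
    ∀ (w : List (Fin 3)) (S : List Word), factorize w = S →
      (∀ t₁ t₂ : Word, t = t₁ * t₂ → ∀ s ∈ S, t₂ ≤ s) →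
      factorize (foliage t ++ w) = absorb t S := by
  induction t with
  | of i =>
    intro w S hw _
    simp only [foliage, factorize, List.cons_append, List.nil_append, List.foldr_cons]
    rw [← hw]; rfl
  | mul t₁ t₂ ih₁ ih₂ =>
    intro w S hw hS
    obtain ⟨h₁, h₂, h₁₂, hreg⟩ := isRegularWord_mul.1 ht
    have hle := hS t₁ t₂ rfl
    rw [FreeMagma.mul_eq, foliage_mul, List.append_assoc]
    have hw₂ : factorize (foliage t₂ ++ w) = t₂ :: S := by
      rw [ih₂ h₂ w S hw, absorb_of_head_le hle]
      rintro a b rfl s hs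
      refine le_trans (le_of_lt ?_) (hle s hs)
      refine Word.lt_of_length_lt ?_
      have := FreeMagma.length_pos a
      rw [Word.length_mul]; omega
    rw [ih₁ h₁ _ _ hw₂, absorb, if_pos h₁₂]
    rintro a b hab s hs
    have hb := hreg a b hab
    rcases List.mem_cons.1 hs with rfl | hs
    · exact hb
    · exact hb.trans (hle s hs)

/-- An increasing sequence of regular words is recovered from its letters. -/
theorem factorize_flatMap_foliage {S : List Word} (hreg : ∀ s ∈ S, IsRegularWord s)
    (hS : S.Pairwise (· ≤ ·)) : factorize (S.flatMap foliage) = S := by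
  induction S with
  | nil => rfl
  | cons t S ih =>
    obtain ⟨hle, hS⟩ := List.pairwise_cons.1 hS
    rw [List.flatMap_cons, factorize_foliage_append (hreg t (by simp)) _ S
      (ih (fun s hs => hreg s (by simp [hs])) hS), absorb_of_head_le hle]
    rintro a b rfl s hs
    refine le_trans (le_of_lt ?_) (hle s hs)
    refine Word.lt_of_length_lt ?_
    have := FreeMagma.length_pos a
    rw [Word.length_mul]; omega

theorem sum_length_absorb (t : Word) (S : List Word) :
    ((absorb t S).map FreeMagma.length).sum = t.length + (S.map FreeMagma.length).sum := by
  induction S generalizing t with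
  | nil => rfl
  | cons s S ih =>
    rw [absorb]
    split_ifs
    · rw [ih, Word.length_mul, List.map_cons, List.sum_cons, add_assoc]
    · rw [List.map_cons, List.sum_cons]

theorem sum_length_factorize (w : List (Fin 3)) :
    ((factorize w).map FreeMagma.length).sum = w.length := by
  induction w with
  | nil => rfl
  | cons i w ih =>
    change ((absorb (FreeMagma.of i) (factorize w)).map FreeMagma.length).sum = _
    rw [sum_length_absorb, ih, List.length_cons, Word.length_of, add_comm]

/-! ### The increasing products form a basis -/

section Basis

variable (Φ : Type*) [CommRing Φ]

/-- The elements of degree at most `n` of the free associative algebra. -/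
def degLE (n : ℕ) : Submodule Φ (U Φ) :=
  Submodule.span Φ
    ((fun w => MonoidAlgebra.single w 1) '' {w : FreeMonoid (Fin 3) | w.length ≤ n})

/-- The endomorphism of the free associative algebra which sends a word of letters to the
associative product of its factorization. -/
def factorizeMap : U Φ →ₗ[Φ] U Φ :=
  Finsupp.linearCombination Φ (fun w : FreeMonoid (Fin 3) => listProd Φ (factorize w.toList)) ∘ₗ
    (MonoidAlgebra.coeffLinearEquiv Φ).toLinearMap

variable {Φ}

theorem factorizeMap_single (w : FreeMonoid (Fin 3)) (c : Φ) :
    factorizeMap Φ (MonoidAlgebra.single w c) = c • listProd Φ (factorize w.toList) := by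
  simp [factorizeMap]

theorem single_mem_degLE {w : FreeMonoid (Fin 3)} {n : ℕ} (h : w.length ≤ n) (c : Φ) :
    MonoidAlgebra.single w c ∈ degLE Φ n := by
  have := (degLE Φ n).smul_mem c (Submodule.subset_span ⟨w, h, rfl⟩)
  simpa [MonoidAlgebra.smul_single] using this

theorem degLE_mono {m n : ℕ} (h : m ≤ n) : degLE Φ m ≤ degLE Φ n :=
  Submodule.span_mono (Set.image_mono fun _ hw => le_trans hw h)

theorem mul_mem_degLE {m n : ℕ} {a b : U Φ} (ha : a ∈ degLE Φ m) (hb : b ∈ degLE Φ n) :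
    a * b ∈ degLE Φ (m + n) := by
  have hle : degLE Φ m * degLE Φ n ≤ degLE Φ (m + n) := by
    rw [degLE, degLE, Submodule.span_mul_span, Submodule.span_le]
    rintro _ ⟨_, ⟨v, hv, rfl⟩, _, ⟨w, hw, rfl⟩, rfl⟩
    change MonoidAlgebra.single v (1 : Φ) * MonoidAlgebra.single w 1 ∈ degLE Φ (m + n)
    rw [MonoidAlgebra.single_mul_single]
    refine single_mem_degLE ?_ _
    rw [FreeMonoid.length_mul]
    exact add_le_add hv hw
  exact hle (Submodule.mul_mem_mul ha hb)

theorem exists_mem_degLE (a : U Φ) : ∃ n, a ∈ degLE Φ n := by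
  induction a using MonoidAlgebra.induction_linear with
  | zero => exact ⟨0, Submodule.zero_mem _⟩
  | add a b ha hb =>
    obtain ⟨m, hm⟩ := ha
    obtain ⟨n, hn⟩ := hb
    exact ⟨max m n, Submodule.add_mem _ (degLE_mono (le_max_left m n) hm)
      (degLE_mono (le_max_right m n) hn)⟩
  | single w c => exact ⟨_, single_mem_degLE le_rfl c⟩

theorem toU_wordElement_mem_degLE (w : Word) : toU Φ (wordElement Φ w) ∈ degLE Φ w.length := by
  induction w with
  | of i =>
    have h : toU Φ (wordElement Φ (FreeMagma.of i)) =
        MonoidAlgebra.single (FreeMonoid.of i) 1 := toU_x i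
    rw [h]
    exact single_mem_degLE (le_of_eq (FreeMonoid.length_of i)) _
  | mul u v ihu ihv =>
    change toU Φ ⁅wordElement Φ u, wordElement Φ v⁆ ∈ degLE Φ (u.length + v.length)
    rw [toU_lie]
    have h₁ := mul_mem_degLE ihu ihv
    have h₂ := mul_mem_degLE ihv ihu
    rw [add_comm v.length] at h₂
    exact (degLE Φ (u.length + v.length)).sub_mem h₁ h₂

theorem listProd_mem_degLE (S : List Word) :
    listProd Φ S ∈ degLE Φ (S.map FreeMagma.length).sum := by
  induction S with
  | nil => exact single_mem_degLE (w := 1) le_rfl 1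
  | cons s S ih =>
    have : listProd Φ (s :: S) = toU Φ (wordElement Φ s) * listProd Φ S := by simp [listProd]
    rw [this, List.map_cons, List.sum_cons]
    exact mul_mem_degLE (toU_wordElement_mem_degLE s) ih

theorem factorizeMap_mem_degLE {n : ℕ} {a : U Φ} (ha : a ∈ degLE Φ n) :
    factorizeMap Φ a ∈ degLE Φ n := by
  have hle : (degLE Φ n).map (factorizeMap Φ) ≤ degLE Φ n := by
    rw [degLE, Submodule.map_span, Submodule.span_le]
    rintro _ ⟨_, ⟨w, hw, rfl⟩, rfl⟩
    rw [factorizeMap_single, one_smul]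
    refine degLE_mono ?_ (listProd_mem_degLE _)
    rw [sum_length_factorize]
    exact hw
  exact hle ⟨a, ha, rfl⟩

/-- The letters of an increasing list of regular words. -/
def letters (s : RegularWord →₀ ℕ) : FreeMonoid (Fin 3) :=
  FreeMonoid.ofList (((sortedList s).map (·.1)).flatMap foliage)

theorem factorize_letters (s : RegularWord →₀ ℕ) :
    factorize (letters s).toList = (sortedList s).map (·.1) := by
  refine factorize_flatMap_foliage ?_ ?_
  · intro t ht
    obtain ⟨v, -, rfl⟩ := List.mem_map.1 ht
    exact v.2
  · rw [List.pairwise_map]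
    exact Multiset.pairwise_sort _ _

theorem length_letters (s : RegularWord →₀ ℕ) :
    (letters s).length = totalLength (sortedList s) := by
  change (letters s).toList.length = _
  rw [← sum_length_factorize, factorize_letters, totalLength, List.map_map]
  rfl

theorem letters_injective : Function.Injective letters := by
  intro s t h
  have h₁ := factorize_letters s
  rw [h, factorize_letters t] at h₁
  have h₂ := (List.map_injective_iff.2 Subtype.val_injective) h₁
  rw [sortedList, sortedList] at h₂
  have h₃ := congrArg (fun l : List RegularWord => (l : Multiset RegularWord)) h₂
  simp only [Multiset.sort_eq] at h₃
  exact (Multiset.toFinsupp.symm.injective h₃).symm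

theorem single_mem_prodSpan (w : FreeMonoid (Fin 3)) :
    MonoidAlgebra.single w (1 : Φ) ∈ prodSpan Φ w.length w.length := by
  have h : regProd Φ (w.toList.map letter) = MonoidAlgebra.single w 1 := by
    induction w using FreeMonoid.recOn with
    | one => rfl
    | of_mul i w ih =>
      rw [FreeMonoid.toList_of_mul, List.map_cons, regProd_cons, ih]
      change toU Φ (x Φ i) * _ = _
      rw [toU_x, MonoidAlgebra.single_mul_single, one_mul]
  rw [← h]
  refine regProd_mem_prodSpan ?_ ?_
  · rw [List.length_map]; rfl
  · refine le_of_eq ?_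
    rw [totalLength, List.map_map]
    have : ((fun v : RegularWord => v.1.length) ∘ letter) = fun _ => 1 := rfl
    rw [this, List.map_const', List.sum_replicate, smul_eq_mul, mul_one]
    rfl

theorem factorizeMap_surjOn (n : ℕ) {a : U Φ} (ha : a ∈ degLE Φ n) :
    ∃ b ∈ degLE Φ n, factorizeMap Φ b = a := by
  have hle : degLE Φ n ≤ (degLE Φ n).map (factorizeMap Φ) := by
    conv_lhs => rw [degLE]
    rw [Submodule.span_le]
    rintro _ ⟨w, hw, rfl⟩
    have h₁ := prodSpan_le_sortedSpan _ _
      (prodSpan_mono hw hw (single_mem_prodSpan (Φ := Φ) w))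
    refine (Submodule.span_le.2 ?_ : sortedSpan Φ n n ≤ _) h₁
    rintro _ ⟨s, ⟨-, hs⟩, rfl⟩
    refine ⟨MonoidAlgebra.single (letters s) 1, single_mem_degLE ?_ 1, ?_⟩
    · rwa [length_letters]
    · rw [factorizeMap_single, one_smul, factorize_letters]; rfl
  exact hle ha

theorem factorizeMap_injective : Function.Injective (factorizeMap Φ) := by
  rw [injective_iff_map_eq_zero]
  intro a ha
  obtain ⟨n, hn⟩ := exists_mem_degLE a
  have hfin : (degLE Φ n).FG :=
    Submodule.fg_span ((List.finite_length_le (Fin 3) n).image _)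
  have : Module.Finite Φ (degLE Φ n) := Module.Finite.iff_fg.2 hfin
  have hsurj : Function.Surjective
      ((factorizeMap Φ).restrict fun a (ha : a ∈ degLE Φ n) => factorizeMap_mem_degLE ha) := by
    rintro ⟨b, hb⟩
    obtain ⟨c, hc, rfl⟩ := factorizeMap_surjOn n hb
    exact ⟨⟨c, hc⟩, rfl⟩
  have hinj := OrzechProperty.injective_of_surjective_endomorphism _ hsurj
  have h0 : (⟨a, hn⟩ : degLE Φ n) = 0 := hinj (by ext1; simpa using ha)
  exact congrArg Subtype.val h0

/-- The increasing products of regular words are linearly independent: they are the images under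
`factorizeMap` of distinct words of letters. -/
theorem pbwMap_injective : Function.Injective (pbwMap Φ) := by
  let e : MvPolynomial RegularWord Φ →ₗ[Φ] U Φ :=
    (MonoidAlgebra.coeffLinearEquiv Φ).symm.toLinearMap ∘ₗ Finsupp.lmapDomain Φ Φ letters ∘ₗ
      (MvPolynomial.basisMonomials RegularWord Φ).repr.toLinearMap
  have he : Function.Injective e :=
    (MonoidAlgebra.coeffLinearEquiv Φ).symm.injective.comp
      ((Finsupp.mapDomain_injective letters_injective).comp
        (MvPolynomial.basisMonomials RegularWord Φ).repr.injective)
  have hcomp : factorizeMap Φ ∘ₗ e = pbwMap Φ := by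
    refine (MvPolynomial.basisMonomials RegularWord Φ).ext fun s => ?_
    have h₁ : e (MvPolynomial.basisMonomials RegularWord Φ s) =
        MonoidAlgebra.single (letters s) 1 := by
      simp only [e, LinearMap.comp_apply, LinearEquiv.coe_coe, Module.Basis.repr_self,
        Finsupp.lmapDomain_apply, Finsupp.mapDomain_single]
      rfl
    rw [LinearMap.comp_apply, h₁, factorizeMap_single, factorize_letters, one_smul,
      MvPolynomial.coe_basisMonomials, pbwMap_monomial, one_smul]
    rfl
  rw [← hcomp]
  exact factorizeMap_injective.comp he

theorem exists_pbwMap_eq (a : U Φ) : ∃ p, pbwMap Φ p = a := by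
  induction a using MonoidAlgebra.induction_linear with
  | zero => exact ⟨0, map_zero _⟩
  | add a b ha hb =>
    obtain ⟨p, rfl⟩ := ha
    obtain ⟨q, rfl⟩ := hb
    exact ⟨p + q, map_add _ _ _⟩
  | single w c =>
    obtain ⟨p, -, hp⟩ := sortedSpan_le_map_pbwMap
      (prodSpan_le_sortedSpan _ _ (single_mem_prodSpan (Φ := Φ) w))
    refine ⟨c • p, ?_⟩
    rw [map_smul, hp, MonoidAlgebra.smul_single, smul_eq_mul, mul_one]

end Basis

/-! ### The basis of regular words -/

section RegularBasis

variable (Φ : Type*) [CommRing Φ]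

/-- The linear combination of regular words with given coefficients. -/
def comb : (RegularWord →₀ Φ) →ₗ[Φ] L Φ :=
  Finsupp.linearCombination Φ fun v : RegularWord => wordElement Φ v.1

/-- The linear form, in the polynomial variables indexed by the regular words, with given
coefficients. -/
def linearForm : (RegularWord →₀ Φ) →ₗ[Φ] MvPolynomial RegularWord Φ :=
  Finsupp.linearCombination Φ MvPolynomial.X

variable {Φ}

theorem comb_single (v : RegularWord) (c : Φ) :
    comb Φ (Finsupp.single v c) = c • wordElement Φ v.1 :=
  Finsupp.linearCombination_single _ _ _

theorem linearForm_single (v : RegularWord) (c : Φ) :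
    linearForm Φ (Finsupp.single v c) = c • MvPolynomial.X v :=
  Finsupp.linearCombination_single _ _ _

theorem coeff_linearForm (c : RegularWord →₀ Φ) (v : RegularWord) :
    MvPolynomial.coeff (Finsupp.single v 1) (linearForm Φ c) = c v := by
  classical
  induction c using Finsupp.induction_linear with
  | zero => simp
  | add c d hc hd => rw [map_add, MvPolynomial.coeff_add, hc, hd, Finsupp.add_apply]
  | single w a =>
    rw [linearForm_single, MvPolynomial.coeff_smul, MvPolynomial.coeff_X, smul_eq_mul]
    by_cases h : w = v
    · simp [h]
    · rw [if_neg (fun h' => h (Finsupp.single_left_injective one_ne_zero h')),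
        Finsupp.single_eq_of_ne (Ne.symm h), mul_zero]

theorem linearForm_injective : Function.Injective (linearForm Φ) := by
  intro c d h
  ext v
  rw [← coeff_linearForm, h, coeff_linearForm]

theorem totalDegree_linearForm_le (c : RegularWord →₀ Φ) :
    (linearForm Φ c).totalDegree ≤ 1 := by
  have h : linearForm Φ c ∈ MvPolynomial.restrictTotalDegree RegularWord Φ 1 := by
    induction c using Finsupp.induction_linear with
    | zero => rw [map_zero]; exact Submodule.zero_mem _
    | add c d hc hd => rw [map_add]; exact Submodule.add_mem _ hc hd
    | single w a =>
      rw [linearForm_single]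
      refine Submodule.smul_mem _ _ ((MvPolynomial.mem_restrictTotalDegree _ _ _).2 ?_)
      refine (MvPolynomial.totalDegree_monomial_le _ _).trans ?_
      simp
  exact (MvPolynomial.mem_restrictTotalDegree _ _ _).1 h

theorem sortedList_single (v : RegularWord) : sortedList (Finsupp.single v 1) = [v] := by
  simp [sortedList]

theorem toU_comb (c : RegularWord →₀ Φ) : toU Φ (comb Φ c) = pbwMap Φ (linearForm Φ c) := by
  induction c using Finsupp.induction_linear with
  | zero => simp
  | add c d hc hd => rw [map_add, map_add, map_add, map_add, hc, hd]
  | single v a =>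
    rw [comb_single, linearForm_single, map_smul, map_smul, MvPolynomial.X, pbwMap_monomial,
      one_smul, sortedList_single, regProd_singleton]

theorem comb_injective : Function.Injective (comb Φ) := by
  intro c d h
  apply linearForm_injective
  apply pbwMap_injective
  rw [← toU_comb, h, toU_comb]

theorem comb_surjective : Function.Surjective (comb Φ) := by
  rw [← LinearMap.range_eq_top, comb, Finsupp.range_linearCombination]
  exact span_regularWord_eq_top

theorem comb_regularCoeffs (f : L Φ) : comb Φ (regularCoeffs f) = f :=
  Function.invFun_eq (comb_surjective f)

theorem regularCoeffs_comb (c : RegularWord →₀ Φ) : regularCoeffs (comb Φ c) = c :=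
  comb_injective (comb_regularCoeffs _)

theorem regularCoeffs_add (f g : L Φ) :
    regularCoeffs (f + g) = regularCoeffs f + regularCoeffs g := by
  apply comb_injective
  rw [map_add, comb_regularCoeffs, comb_regularCoeffs, comb_regularCoeffs]

theorem regularCoeffs_smul (c : Φ) (f : L Φ) :
    regularCoeffs (c • f) = c • regularCoeffs f := by
  apply comb_injective
  rw [map_smul, comb_regularCoeffs, comb_regularCoeffs]

theorem regularCoeffs_wordElement (v : RegularWord) :
    regularCoeffs (wordElement Φ v.1) = Finsupp.single v 1 := by
  rw [← regularCoeffs_comb (Finsupp.single v (1 : Φ)), comb_single, one_smul]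

theorem regularCoeffs_eq_zero {f : L Φ} : regularCoeffs f = 0 ↔ f = 0 := by
  constructor
  · intro h
    rw [← comb_regularCoeffs f, h, map_zero]
  · rintro rfl
    simpa using regularCoeffs_smul (0 : Φ) 0

theorem toU_eq (f : L Φ) : toU Φ f = pbwMap Φ (linearForm Φ (regularCoeffs f)) := by
  rw [← toU_comb, comb_regularCoeffs]

theorem toU_injective : Function.Injective (toU Φ) := by
  intro f g h
  rw [toU_eq, toU_eq] at h
  have := linearForm_injective (pbwMap_injective h)
  rw [← comb_regularCoeffs f, this, comb_regularCoeffs]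

/-! ### Left multiples of a Lie element -/

theorem sortedList_add_single (s : RegularWord →₀ ℕ) (v : RegularWord) :
    (v :: sortedList s).Perm (sortedList (Finsupp.single v 1 + s)) := by
  rw [← Multiset.coe_eq_coe, ← Multiset.cons_coe, sortedList, sortedList, Multiset.sort_eq,
    Multiset.sort_eq, map_add, Finsupp.toMultiset_single, one_smul, Multiset.singleton_add]

/-- Left multiplication by a Lie element corresponds, up to terms of lower degree, to the
multiplication of polynomials by its linear form. -/
theorem exists_toU_mul_pbwMap (f : L Φ) {k : ℕ} {p : MvPolynomial RegularWord Φ}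
    (hp : p.totalDegree ≤ k) :
    ∃ r : MvPolynomial RegularWord Φ, r.totalDegree ≤ k ∧
      toU Φ f * pbwMap Φ p = pbwMap Φ (linearForm Φ (regularCoeffs f) * p + r) := by
  let R : Submodule Φ (U Φ) :=
    (MvPolynomial.restrictTotalDegree RegularWord Φ k).map (pbwMap Φ)
  have key : ∀ (v : RegularWord) (s : RegularWord →₀ ℕ) (a : Φ), (s.sum fun _ => id) ≤ k →
      toU Φ (wordElement Φ v.1) * pbwMap Φ (MvPolynomial.monomial s a) -
        pbwMap Φ (MvPolynomial.X v * MvPolynomial.monomial s a) ∈ R := by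
    intro v s a hs
    rw [MvPolynomial.X, MvPolynomial.monomial_mul, one_mul, pbwMap_monomial, pbwMap_monomial,
      mul_smul_comm, ← smul_sub, ← regProd_cons]
    refine R.smul_mem a ?_
    have h₁ := regProd_sub_mem_of_perm (Φ := Φ) (sortedList_add_single s v) k _
      (by rw [List.length_cons, length_sortedList]; omega) le_rfl
    obtain ⟨r, hr, h⟩ := sortedSpan_le_map_pbwMap (prodSpan_le_sortedSpan _ _ h₁)
    exact ⟨r, (MvPolynomial.mem_restrictTotalDegree _ _ r).2 hr, h⟩
  have key₂ : ∀ v : RegularWord, toU Φ (wordElement Φ v.1) * pbwMap Φ p -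
      pbwMap Φ (MvPolynomial.X v * p) ∈ R := by
    intro v
    rw [p.as_sum, map_sum, Finset.mul_sum, Finset.mul_sum, map_sum, ← Finset.sum_sub_distrib]
    exact R.sum_mem fun s hs =>
      key v s _ ((MvPolynomial.le_totalDegree hs).trans hp)
  have key₃ : ∀ c : RegularWord →₀ Φ, toU Φ (comb Φ c) * pbwMap Φ p -
      pbwMap Φ (linearForm Φ c * p) ∈ R := by
    intro c
    induction c using Finsupp.induction_linear with
    | zero => simp
    | add c d hc hd =>
      have := R.add_mem hc hd
      rw [map_add, map_add, map_add, add_mul, add_mul, map_add]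
      convert this using 1
      abel
    | single v a =>
      rw [comb_single, linearForm_single, map_smul, smul_mul_assoc, smul_mul_assoc, map_smul,
        ← smul_sub]
      exact R.smul_mem a (key₂ v)
  obtain ⟨r, hr, h⟩ := key₃ (regularCoeffs f)
  refine ⟨r, (MvPolynomial.mem_restrictTotalDegree _ _ r).1 hr, ?_⟩
  rw [map_add, h, comb_regularCoeffs]
  abel

/-- Over a domain, a Lie element is a left multiple of another one only if it is a scalar multiple:
multiplication by a Lie element raises the degree of the associated commutative polynomial
by one. -/
theorem exists_smul_eq_of_toU_mul [IsDomain Φ] {f g : L Φ} {a : U Φ}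
    (h : toU Φ f = toU Φ g * a) : ∃ c : Φ, f = c • g := by
  by_cases hg : g = 0
  · refine ⟨0, toU_injective ?_⟩
    rw [h, hg]; simp
  obtain ⟨p, rfl⟩ := exists_pbwMap_eq a
  obtain ⟨r, hr, hmul⟩ := exists_toU_mul_pbwMap g (le_refl p.totalDegree)
  have hpoly : linearForm Φ (regularCoeffs f) = linearForm Φ (regularCoeffs g) * p + r := by
    apply pbwMap_injective
    rw [← toU_eq, h, hmul]
  rcases Nat.eq_zero_or_pos p.totalDegree with h0 | hpos
  · rw [MvPolynomial.totalDegree_eq_zero_iff_eq_C] at h0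
    refine ⟨MvPolynomial.coeff 0 p, toU_injective ?_⟩
    rw [h, h0, map_smul, MvPolynomial.coeff_C, if_pos rfl, MvPolynomial.C_apply, pbwMap_monomial]
    simp [sortedList, regProd, listProd]
  · exfalso
    have hg' : linearForm Φ (regularCoeffs g) ≠ 0 := by
      rw [Ne, map_eq_zero_iff _ linearForm_injective, regularCoeffs_eq_zero]
      exact hg
    have hp : p ≠ 0 := by
      rintro rfl
      simp at hpos
    have hdeg : (linearForm Φ (regularCoeffs g)).totalDegree = 1 := by
      refine le_antisymm (totalDegree_linearForm_le _) ?_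
      rw [Nat.one_le_iff_ne_zero, Ne, MvPolynomial.totalDegree_eq_zero_iff_eq_C]
      intro hC
      apply hg
      rw [← regularCoeffs_eq_zero]
      ext v
      rw [← coeff_linearForm, hC, MvPolynomial.coeff_C, if_neg]
      · rfl
      · intro h'
        have := congrArg (fun s : RegularWord →₀ ℕ => s v) h'
        simp at this
    have h₁ := MvPolynomial.totalDegree_mul_of_isDomain hg' hp
    have h₂ : linearForm Φ (regularCoeffs g) * p = linearForm Φ (regularCoeffs f) - r := by
      rw [hpoly]; ring
    have h₃ := MvPolynomial.totalDegree_sub (linearForm Φ (regularCoeffs f)) r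
    rw [← h₂, h₁, hdeg] at h₃
    have h₄ := totalDegree_linearForm_le (regularCoeffs f)
    rcases le_max_iff.1 h₃ with h₅ | h₅ <;> omega

end RegularBasis

/-! ### Leading words -/

section Leading

variable {Φ : Type*} [CommRing Φ]

theorem regularCoeffs_sub (f g : L Φ) :
    regularCoeffs (f - g) = regularCoeffs f - regularCoeffs g := by
  rw [sub_eq_add_neg, sub_eq_add_neg, regularCoeffs_add, ← neg_one_smul Φ g, regularCoeffs_smul,
    neg_one_smul]

theorem lm_zero : lm (0 : L Φ) = letter 2 := by
  rw [lm, dif_neg]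
  simp [regularCoeffs_eq_zero.2 rfl]

theorem regularCoeffs_eq_zero_of_lm_lt {f : L Φ} {v : RegularWord} (h : lm f < v) :
    regularCoeffs f v = 0 := by
  by_contra hv
  have hmem : v ∈ (regularCoeffs f).support := Finsupp.mem_support_iff.2 hv
  rw [lm, dif_pos ⟨v, hmem⟩] at h
  exact absurd (Finset.le_max' _ v hmem) (not_le.2 h)

theorem lc_ne_zero {f : L Φ} (hf : f ≠ 0) : lc f ≠ 0 := by
  have hne : (regularCoeffs f).support.Nonempty := by
    rw [Finsupp.support_nonempty_iff, Ne, regularCoeffs_eq_zero]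
    exact hf
  rw [lc, lm, dif_pos hne]
  exact Finsupp.mem_support_iff.1 (Finset.max'_mem _ hne)

/-- The default value `lm 0` is the least regular word, so the equivalence holds for `f = 0` as
well. -/
theorem lm_le_iff {f : L Φ} {u : RegularWord} :
    lm f ≤ u ↔ ∀ v, u < v → regularCoeffs f v = 0 := by
  constructor
  · exact fun h v hv => regularCoeffs_eq_zero_of_lm_lt (h.trans_lt hv)
  · intro h
    by_cases hf : f = 0
    · rw [hf, lm_zero]; exact letter_two_le u
    · by_contra! hlt
      exact lc_ne_zero hf (h _ hlt)

theorem lm_eq_of_coeff {f : L Φ} {u : RegularWord} (hu : regularCoeffs f u ≠ 0)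
    (h : lm f ≤ u) : lm f = u := by
  refine le_antisymm h ?_
  by_contra! hlt
  exact hu (regularCoeffs_eq_zero_of_lm_lt hlt)

theorem lm_add_le {f g : L Φ} {u : RegularWord} (hf : lm f ≤ u) (hg : lm g ≤ u) :
    lm (f + g) ≤ u := by
  rw [lm_le_iff] at *
  intro v hv
  rw [regularCoeffs_add, Finsupp.add_apply, hf v hv, hg v hv, add_zero]

theorem lm_smul_le (c : Φ) (f : L Φ) : lm (c • f) ≤ lm f := by
  rw [lm_le_iff]
  intro v hv
  rw [regularCoeffs_smul, Finsupp.smul_apply, regularCoeffs_eq_zero_of_lm_lt hv, smul_zero]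

theorem lm_sub_le {f g : L Φ} {u : RegularWord} (hf : lm f ≤ u) (hg : lm g ≤ u) :
    lm (f - g) ≤ u := by
  rw [sub_eq_add_neg, ← neg_one_smul Φ g]
  exact lm_add_le hf ((lm_smul_le _ _).trans hg)

theorem lm_smul [IsDomain Φ] {c : Φ} (hc : c ≠ 0) (f : L Φ) : lm (c • f) = lm f := by
  by_cases hf : f = 0
  · rw [hf, smul_zero]
  · refine lm_eq_of_coeff ?_ (lm_smul_le c f)
    rw [regularCoeffs_smul, Finsupp.smul_apply, smul_eq_mul]
    exact mul_ne_zero hc (lc_ne_zero hf)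

/-- The part of `f` which is homogeneous of degree `n`. -/
def homPart (n : ℕ) (f : L Φ) : L Φ :=
  comb Φ ((regularCoeffs f).filter fun v => v.1.length = n)

theorem regularCoeffs_homPart_lm (f : L Φ) :
    regularCoeffs (homPart (lm f).1.length f) (lm f) = lc f := by
  rw [homPart, regularCoeffs_comb, Finsupp.filter_apply, if_pos rfl, lc]

theorem lm_homPart_lm {f : L Φ} (hf : f ≠ 0) : lm (homPart (lm f).1.length f) = lm f := by
  refine lm_eq_of_coeff ?_ ?_
  · rw [regularCoeffs_homPart_lm]; exact lc_ne_zero hf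
  · rw [lm_le_iff]
    intro v hv
    rw [homPart, regularCoeffs_comb]
    by_cases h : v.1.length = (lm f).1.length
    · rw [Finsupp.filter_apply, if_pos h, regularCoeffs_eq_zero_of_lm_lt hv]
    · rw [Finsupp.filter_apply, if_neg h]

end Leading

/-! ### Degrees in the free associative algebra -/

section Degree

open Polynomial

variable (Φ : Type*) [CommRing Φ]

/-- The embedding of the free associative algebra into its polynomial ring in one variable `t`
which multiplies the generators by `t`; it records the grading by degree. -/
def grading : U Φ →ₐ[Φ] (U Φ)[X] :=
  MonoidAlgebra.lift Φ (U Φ)[X] (FreeMonoid (Fin 3))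
    (FreeMonoid.lift fun i => monomial 1 (MonoidAlgebra.single (FreeMonoid.of i) 1))

variable {Φ}

/-- The degree of an element of the free associative algebra, with `deg 0 = 0`. -/
def deg (a : U Φ) : ℕ := (grading Φ a).natDegree

theorem grading_single (w : FreeMonoid (Fin 3)) (c : Φ) :
    grading Φ (MonoidAlgebra.single w c) = monomial w.length (MonoidAlgebra.single w c) := by
  have h : FreeMonoid.lift (fun i => monomial 1 (MonoidAlgebra.single (FreeMonoid.of i) (1 : Φ))) w
      = monomial w.length (MonoidAlgebra.single w 1) := by
    induction w using FreeMonoid.recOn with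
    | one => rfl
    | of_mul i w ih =>
      rw [map_mul, ih, FreeMonoid.lift_eval_of, monomial_mul_monomial,
        MonoidAlgebra.single_mul_single, FreeMonoid.length_mul, FreeMonoid.length_of, one_mul]
  rw [grading, MonoidAlgebra.lift_single, h, smul_monomial, MonoidAlgebra.smul_single, smul_eq_mul,
    mul_one]

theorem eval_one_grading (a : U Φ) : (grading Φ a).eval 1 = a := by
  induction a using MonoidAlgebra.induction_linear with
  | zero => simp
  | add a b ha hb => rw [map_add, eval_add, ha, hb]
  | single w c => rw [grading_single, eval_monomial, one_pow, mul_one]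

theorem grading_ne_zero {a : U Φ} (ha : a ≠ 0) : grading Φ a ≠ 0 := by
  intro h
  apply ha
  rw [← eval_one_grading a, h, eval_zero]

/-- `a` is a linear combination of words of length `n`. -/
def IsHomogeneous (n : ℕ) (a : U Φ) : Prop := ∀ w, a.coeff w ≠ 0 → w.length = n

theorem isHomogeneous_coeff_grading (a : U Φ) (n : ℕ) :
    IsHomogeneous n ((grading Φ a).coeff n) := by
  induction a using MonoidAlgebra.induction_linear with
  | zero => intro w hw; simp at hw
  | add a b ha hb =>
    intro w hw
    rw [map_add, coeff_add, MonoidAlgebra.coeff_add, Finsupp.add_apply] at hw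
    by_cases h : ((grading Φ a).coeff n).coeff w = 0
    · rw [h, zero_add] at hw
      exact hb w hw
    · exact ha w h
  | single v c =>
    classical
    intro w hw
    rw [grading_single, coeff_monomial] at hw
    split_ifs at hw with h
    · rw [MonoidAlgebra.coeff_single, Finsupp.single_apply] at hw
      split_ifs at hw with h'
      · rw [← h', h]
      · exact absurd rfl hw
    · simp at hw

theorem grading_toU_wordElement (w : Word) :
    grading Φ (toU Φ (wordElement Φ w)) = monomial w.length (toU Φ (wordElement Φ w)) := by
  induction w with
  | of i =>
    have h : toU Φ (wordElement Φ (FreeMagma.of i)) =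
        MonoidAlgebra.single (FreeMonoid.of i) 1 := toU_x i
    rw [h, grading_single]; rfl
  | mul u v ihu ihv =>
    change grading Φ (toU Φ ⁅wordElement Φ u, wordElement Φ v⁆) =
      monomial (u.length + v.length) (toU Φ ⁅wordElement Φ u, wordElement Φ v⁆)
    rw [toU_lie, map_sub, map_mul, map_mul, ihu, ihv, monomial_mul_monomial,
      monomial_mul_monomial, add_comm v.length, map_sub]

theorem coeff_grading_toU (f : L Φ) (n : ℕ) :
    (grading Φ (toU Φ f)).coeff n = toU Φ (homPart n f) := by
  have key : ∀ c : RegularWord →₀ Φ, (grading Φ (toU Φ (comb Φ c))).coeff n =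
      toU Φ (comb Φ (c.filter fun v => v.1.length = n)) := by
    intro c
    induction c using Finsupp.induction_linear with
    | zero => rw [Finsupp.filter_zero]; simp
    | add c d hc hd =>
      rw [map_add, map_add, map_add, coeff_add, hc, hd, Finsupp.filter_add, map_add, map_add]
    | single v a =>
      rw [comb_single, map_smul, map_smul, grading_toU_wordElement, coeff_smul, coeff_monomial]
      by_cases h : v.1.length = n
      · rw [if_pos h, Finsupp.filter_single_of_pos (fun v : RegularWord => v.1.length = n) h,
          comb_single, map_smul]
      · rw [if_neg h, Finsupp.filter_single_of_neg (fun v : RegularWord => v.1.length = n) h,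
          map_zero, map_zero, smul_zero]
  rw [homPart, ← key, comb_regularCoeffs]

theorem deg_toU_le (f : L Φ) : deg (toU Φ f) ≤ (lm f).1.length := by
  rw [deg, natDegree_le_iff_coeff_eq_zero]
  intro n hn
  rw [coeff_grading_toU, homPart]
  have : (regularCoeffs f).filter (fun v => v.1.length = n) = 0 := by
    ext v
    by_cases h : v.1.length = n
    · rw [Finsupp.filter_apply, if_pos h]
      exact regularCoeffs_eq_zero_of_lm_lt (Word.lt_of_length_lt (by omega) : (lm f).1 < v.1)
    · rw [Finsupp.filter_apply, if_neg h]; rfl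
  rw [this, map_zero, map_zero]

end Degree

/-! ### Right independence of Lie elements -/

section Independence

variable {Φ : Type*} [CommRing Φ]

/-- The linear map which deletes the suffix `p` from the words ending in `p` and kills the other
words. -/
def strip (p : FreeMonoid (Fin 3)) : U Φ →ₗ[Φ] U Φ :=
  (MonoidAlgebra.coeffLinearEquiv Φ).symm.toLinearMap ∘ₗ
    Finsupp.lcomapDomain (· * p) (mul_left_injective p) ∘ₗ
      (MonoidAlgebra.coeffLinearEquiv Φ).toLinearMap

theorem coeff_strip (p : FreeMonoid (Fin 3)) (a : U Φ) (w : FreeMonoid (Fin 3)) :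
    (strip p a).coeff w = a.coeff (w * p) := rfl

theorem exists_eq_mul_of_length_le {p q s t : FreeMonoid (Fin 3)} (h : p.length ≤ q.length)
    (heq : s * q = t * p) : ∃ r, q = r * p := by
  have h₁ : q.toList <:+ (t * p).toList := by
    rw [← heq, FreeMonoid.toList_mul]; exact List.suffix_append _ _
  have h₂ : p.toList <:+ (t * p).toList := by
    rw [FreeMonoid.toList_mul]; exact List.suffix_append _ _
  obtain ⟨r, hr⟩ := List.suffix_of_suffix_length_le h₂ h₁ h
  exact ⟨FreeMonoid.ofList r, hr.symm⟩

theorem strip_mul_single (p r : FreeMonoid (Fin 3)) (a : U Φ) (c : Φ) :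
    strip p (a * MonoidAlgebra.single (r * p) c) = a * MonoidAlgebra.single r c := by
  have h : a * MonoidAlgebra.single (r * p) c =
      (a * MonoidAlgebra.single r c) * MonoidAlgebra.single p 1 := by
    rw [mul_assoc, MonoidAlgebra.single_mul_single, mul_one]
  ext w
  rw [coeff_strip, h, MonoidAlgebra.coeff_mul_single_eq_coeff_mul w, mul_one]
  intro m _
  exact mul_left_inj p

theorem strip_mul_single_of_not_suffix {p q : FreeMonoid (Fin 3)} (h : p.length ≤ q.length)
    (hq : ∀ r, q ≠ r * p) (a : U Φ) (c : Φ) : strip p (a * MonoidAlgebra.single q c) = 0 := by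
  ext w
  rw [coeff_strip, MonoidAlgebra.coeff_mul_single_of_forall_mul_ne]
  · rfl
  · intro d hd
    obtain ⟨r, hr⟩ := exists_eq_mul_of_length_le h hd
    exact hq r hr

theorem strip_mul_of_length_le {p : FreeMonoid (Fin 3)} (a : U Φ) {b : U Φ}
    (hb : ∀ w, b.coeff w ≠ 0 → p.length ≤ w.length) : strip p (a * b) = a * strip p b := by
  have h := MonoidAlgebra.sum_coeff_single b
  rw [← h, Finsupp.sum, Finset.mul_sum, map_sum, map_sum, Finset.mul_sum]
  refine Finset.sum_congr rfl fun w hw => ?_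
  have hlen := hb w (Finsupp.mem_support_iff.1 hw)
  by_cases hs : ∃ r, w = r * p
  · obtain ⟨r, rfl⟩ := hs
    have h₁ := strip_mul_single p r (1 : U Φ) (b.coeff (r * p))
    rw [one_mul, one_mul] at h₁
    rw [strip_mul_single, h₁]
  · push Not at hs
    have h₁ := strip_mul_single_of_not_suffix hlen hs (1 : U Φ) (b.coeff w)
    rw [one_mul] at h₁
    rw [strip_mul_single_of_not_suffix hlen hs, h₁, mul_zero]

theorem strip_mul_of_isHomogeneous {p : FreeMonoid (Fin 3)} (a : U Φ) {b : U Φ}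
    (hb : IsHomogeneous p.length b) : strip p (a * b) = b.coeff p • a := by
  rw [strip_mul_of_length_le a fun w hw => (hb w hw).ge]
  have : strip p b = MonoidAlgebra.single 1 (b.coeff p) := by
    classical
    ext w
    rw [coeff_strip, MonoidAlgebra.coeff_single, Finsupp.single_apply]
    split_ifs with h
    · rw [← h, one_mul]
    · by_contra hw
      have := hb _ hw
      rw [FreeMonoid.length_mul] at this
      exact h (FreeMonoid.length_eq_zero.1 (by omega)).symm
  rw [this]
  ext w
  rw [MonoidAlgebra.coeff_mul_single_one, MonoidAlgebra.coeff_smul, Finsupp.smul_apply,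
    smul_eq_mul, mul_comm]

variable [IsDomain Φ]

theorem eq_zero_of_toU_mul_add_aux {f g : L Φ}
    (hfg : ∀ c d : Φ, c • f = d • g → c = 0 ∧ d = 0) {k l : ℕ} (hkl : k ≤ l) {a b : U Φ}
    (ha : IsHomogeneous k a) (hb : IsHomogeneous l b)
    (h : toU Φ f * a + toU Φ g * b = 0) : a = 0 ∧ b = 0 := by
  have ha0 : a = 0 := by
    by_contra ha0
    obtain ⟨p, hp⟩ : ∃ p, a.coeff p ≠ 0 := by
      by_contra! hall
      exact ha0 (by ext w; exact hall w)
    have hpk := ha p hp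
    have h₁ := congrArg (strip p) h
    rw [map_add, strip_mul_of_isHomogeneous _ (hpk ▸ ha),
      strip_mul_of_length_le _ (fun w hw => by rw [hpk, hb w hw]; exact hkl), map_zero] at h₁
    have h₂ : toU Φ (a.coeff p • f) = toU Φ g * -strip p b := by
      rw [map_smul, mul_neg]
      exact eq_neg_of_add_eq_zero_left h₁
    obtain ⟨c, hc⟩ := exists_smul_eq_of_toU_mul h₂
    exact hp (hfg _ _ hc).1
  refine ⟨ha0, ?_⟩
  by_contra hb0
  obtain ⟨p, hp⟩ : ∃ p, b.coeff p ≠ 0 := by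
    by_contra! hall
    exact hb0 (by ext w; exact hall w)
  rw [ha0, mul_zero, zero_add] at h
  have h₁ := congrArg (strip p) h
  rw [strip_mul_of_isHomogeneous _ ((hb p hp) ▸ hb), map_zero, ← map_smul] at h₁
  have h₂ : b.coeff p • g = 0 := toU_injective (by rw [h₁, map_zero])
  exact hp (hfg 0 (b.coeff p) (by rw [h₂, zero_smul])).2

/-- Two linearly independent Lie elements are right independent over the free associative algebra,
at least as concerns homogeneous coefficients. Deleting a suffix of maximal length from a relation
exhibits a multiple of one of the elements as a left multiple of the other one. -/
theorem eq_zero_of_toU_mul_add {f g : L Φ}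
    (hfg : ∀ c d : Φ, c • f = d • g → c = 0 ∧ d = 0) {k l : ℕ} {a b : U Φ}
    (ha : IsHomogeneous k a) (hb : IsHomogeneous l b)
    (h : toU Φ f * a + toU Φ g * b = 0) : a = 0 ∧ b = 0 := by
  rcases le_total k l with hkl | hkl
  · exact eq_zero_of_toU_mul_add_aux hfg hkl ha hb h
  · rw [add_comm] at h
    exact (eq_zero_of_toU_mul_add_aux (fun c d hcd => (hfg d c hcd.symm).symm) hkl hb ha h).symm

theorem homPart_independent {f g : L Φ} (hf : f ≠ 0) (hg : g ≠ 0) (hfg : lm f ≠ lm g) (c d : Φ)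
    (h : c • homPart (lm f).1.length f = d • homPart (lm g).1.length g) : c = 0 ∧ d = 0 := by
  have hf₁ := lm_homPart_lm hf
  have hg₁ := lm_homPart_lm hg
  have hf₀ : homPart (lm f).1.length f ≠ 0 := by
    intro h0
    apply lc_ne_zero hf
    rw [← regularCoeffs_homPart_lm, h0, regularCoeffs_eq_zero.2 rfl]; rfl
  have hg₀ : homPart (lm g).1.length g ≠ 0 := by
    intro h0
    apply lc_ne_zero hg
    rw [← regularCoeffs_homPart_lm, h0, regularCoeffs_eq_zero.2 rfl]; rfl
  have hz : ∀ {e : Φ} {k : L Φ}, e • k = 0 → k ≠ 0 → e = 0 := by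
    intro e k hek hk
    by_contra he
    have h₁ : regularCoeffs (e • k) (lm k) = e * lc k := by
      rw [regularCoeffs_smul, Finsupp.smul_apply, smul_eq_mul, lc]
    rw [hek, regularCoeffs_eq_zero.2 rfl] at h₁
    exact mul_ne_zero he (lc_ne_zero hk) h₁.symm
  by_cases hc : c = 0
  · rw [hc, zero_smul] at h
    exact ⟨hc, hz h.symm hg₀⟩
  · by_cases hd : d = 0
    · rw [hd, zero_smul] at h
      exact absurd (hz h hf₀) hc
    · have := congrArg lm h
      rw [lm_smul hc, lm_smul hd, hf₁, hg₁] at this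
      exact absurd this hfg

theorem le_deg_aux {f g : L Φ} (hf : f ≠ 0) (hg : g ≠ 0) (hfg : lm f ≠ lm g) {a b : U Φ}
    (ha : a ≠ 0) (hb : b = 0 ∨ (lm g).1.length + deg b ≤ (lm f).1.length + deg a) :
    (lm f).1.length + deg a ≤ deg (toU Φ f * a + toU Φ g * b) := by
  refine Polynomial.le_natDegree_of_ne_zero fun h => ?_
  rw [map_add, Polynomial.coeff_add, map_mul, map_mul,
    Polynomial.coeff_mul_add_eq_of_natDegree_le (deg_toU_le f) (le_refl (deg a)),
    coeff_grading_toU] at h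
  have hlead : (grading Φ a).coeff (deg a) ≠ 0 :=
    Polynomial.leadingCoeff_ne_zero.2 (grading_ne_zero ha)
  rcases hb with rfl | hb
  · refine hlead (eq_zero_of_toU_mul_add (homPart_independent hf hg hfg)
      (isHomogeneous_coeff_grading a _) (l := 0) (b := 0) (by intro w hw; simp at hw) ?_).1
    rw [mul_zero, add_zero]
    simpa using h
  · obtain ⟨l, hl⟩ := Nat.exists_eq_add_of_le ((Nat.le_add_right _ _).trans hb)
    rw [hl, Polynomial.coeff_mul_add_eq_of_natDegree_le (deg_toU_le g)
      (show deg b ≤ l by omega), coeff_grading_toU] at h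
    exact hlead (eq_zero_of_toU_mul_add (homPart_independent hf hg hfg)
      (isHomogeneous_coeff_grading a _) (isHomogeneous_coeff_grading b _) h).1

/-- No cancellation of leading terms occurs in `f a + g b`, for Lie elements `f` and `g` with
distinct leading words. -/
theorem le_deg_toU_mul_add {f g : L Φ} (hf : f ≠ 0) (hg : g ≠ 0) (hfg : lm f ≠ lm g) {a : U Φ}
    (b : U Φ) (ha : a ≠ 0) : (lm f).1.length + deg a ≤ deg (toU Φ f * a + toU Φ g * b) := by
  by_cases hb : b = 0
  · exact le_deg_aux hf hg hfg ha (Or.inl hb)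
  · rcases le_total ((lm g).1.length + deg b) ((lm f).1.length + deg a) with h | h
    · exact le_deg_aux hf hg hfg ha (Or.inr h)
    · have := le_deg_aux hg hf hfg.symm hb (Or.inr h)
      rw [add_comm (toU Φ g * b)] at this
      exact h.trans this

end Independence

/-! ### Subalgebras generated by two elements -/

section TwoGenerated

variable {Φ : Type*} [CommRing Φ]

/-- The value of a noncommutative polynomial in two variables at a pair of Lie elements. -/
def evalPair (F : Bool → L Φ) : MonoidAlgebra Φ (FreeMonoid Bool) →ₐ[Φ] U Φ :=
  MonoidAlgebra.lift Φ (U Φ) (FreeMonoid Bool) (FreeMonoid.lift fun b => toU Φ (F b))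

/-- The weight of a word in two variables which is substituted by the elements of a pair. -/
def weight (F : Bool → L Φ) (w : FreeMonoid Bool) : ℕ :=
  (w.toList.map fun b => (lm (F b)).1.length).sum

/-- The linear map which deletes the first letter `b` from the words starting with `b` and kills
the other words. -/
def tail (b : Bool) : MonoidAlgebra Φ (FreeMonoid Bool) →ₗ[Φ] MonoidAlgebra Φ (FreeMonoid Bool) :=
  (MonoidAlgebra.coeffLinearEquiv Φ).symm.toLinearMap ∘ₗ
    Finsupp.lcomapDomain (FreeMonoid.of b * ·) (mul_right_injective (FreeMonoid.of b)) ∘ₗ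
      (MonoidAlgebra.coeffLinearEquiv Φ).toLinearMap

theorem coeff_tail (b : Bool) (P : MonoidAlgebra Φ (FreeMonoid Bool)) (w : FreeMonoid Bool) :
    (tail b P).coeff w = P.coeff (FreeMonoid.of b * w) := rfl

theorem eq_const_add_tail (P : MonoidAlgebra Φ (FreeMonoid Bool)) :
    P = MonoidAlgebra.single 1 (P.coeff 1) +
      (MonoidAlgebra.single (FreeMonoid.of true) 1 * tail true P +
        MonoidAlgebra.single (FreeMonoid.of false) 1 * tail false P) := by
  classical
  ext w
  simp only [MonoidAlgebra.coeff_add, Finsupp.add_apply, MonoidAlgebra.coeff_single]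
  induction w using FreeMonoid.casesOn with
  | one =>
    rw [Finsupp.single_eq_same, MonoidAlgebra.coeff_single_mul_of_forall_mul_ne,
      MonoidAlgebra.coeff_single_mul_of_forall_mul_ne, add_zero, add_zero]
    all_goals
      intro d hd
      have := congrArg FreeMonoid.length hd
      simp at this
  | of_mul b w =>
    have hne : FreeMonoid.of b * w ≠ 1 := by
      intro hd
      have := congrArg FreeMonoid.length hd
      simp at this
    have hsame : ∀ b' : Bool, (MonoidAlgebra.single (FreeMonoid.of b') (1 : Φ) * tail b' P).coeff
        (FreeMonoid.of b * w) = if b' = b then P.coeff (FreeMonoid.of b * w) else 0 := by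
      intro b'
      split_ifs with h
      · subst h
        rw [MonoidAlgebra.coeff_single_mul_eq_mul_coeff w, one_mul, coeff_tail]
        intro m _
        exact mul_right_inj _
      · rw [MonoidAlgebra.coeff_single_mul_of_forall_mul_ne]
        intro d hd
        exact h (List.cons.inj hd).1
    rw [Finsupp.single_eq_of_ne hne, hsame, hsame]
    cases b <;> simp

theorem evalPair_single_of_mul (F : Bool → L Φ) (b : Bool) (P : MonoidAlgebra Φ (FreeMonoid Bool)) :
    evalPair F (MonoidAlgebra.single (FreeMonoid.of b) 1 * P) = toU Φ (F b) * evalPair F P := by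
  rw [map_mul]
  congr 1
  rw [evalPair, MonoidAlgebra.lift_single, one_smul, FreeMonoid.lift_eval_of]

theorem evalPair_eq (F : Bool → L Φ) (P : MonoidAlgebra Φ (FreeMonoid Bool)) :
    evalPair F P = MonoidAlgebra.single 1 (P.coeff 1) +
      (toU Φ (F true) * evalPair F (tail true P) +
        toU Φ (F false) * evalPair F (tail false P)) := by
  conv_lhs => rw [eq_const_add_tail P]
  rw [map_add, map_add, evalPair_single_of_mul, evalPair_single_of_mul]
  congr 1
  rw [evalPair, MonoidAlgebra.lift_single, (FreeMonoid.lift _).map_one, MonoidAlgebra.one_def,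
    MonoidAlgebra.smul_single, smul_eq_mul, mul_one]

theorem deg_single_one_add {a : U Φ} (ha : 0 < deg a) (c : Φ) :
    deg (MonoidAlgebra.single 1 c + a) = deg a := by
  rw [deg, map_add, grading_single]
  refine Polynomial.natDegree_add_eq_right_of_natDegree_lt ?_
  exact lt_of_le_of_lt (Polynomial.natDegree_monomial_le _) ha

theorem deg_zero : deg (0 : U Φ) = 0 := by
  rw [deg, map_zero, Polynomial.natDegree_zero]

/-- Every Lie element generated by a pair is the value of a polynomial whose words, apart from the
two variables, involve both of them. -/
theorem exists_evalPair_eq {F : Bool → L Φ} {h : L Φ}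
    (hh : h ∈ LieSubalgebra.lieSpan Φ (L Φ) (Set.range F)) :
    ∃ P : MonoidAlgebra Φ (FreeMonoid Bool), evalPair F P = toU Φ h ∧
      ∀ w, P.coeff w ≠ 0 → (∃ b, w = FreeMonoid.of b) ∨ ∀ b, b ∈ w.toList := by
  let T : Set (FreeMonoid Bool) := {w | (∃ b, w = FreeMonoid.of b) ∨ ∀ b, b ∈ w.toList}
  let M : Submodule Φ (MonoidAlgebra Φ (FreeMonoid Bool)) :=
    Submodule.span Φ ((fun w => MonoidAlgebra.single w 1) '' T)
  have hlie : ∀ P ∈ M, ∀ Q ∈ M, P * Q - Q * P ∈ M := by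
    intro P hP Q hQ
    refine Submodule.span_induction₂ (p := fun P Q _ _ => P * Q - Q * P ∈ M)
      ?_ ?_ ?_ ?_ ?_ ?_ ?_ hP hQ
    · rintro _ _ ⟨p, hp, rfl⟩ ⟨q, hq, rfl⟩
      simp only [MonoidAlgebra.single_mul_single, one_mul]
      by_cases hpq : p = q
      · rw [hpq, sub_self]; exact M.zero_mem
      · have hboth : ∀ b, b ∈ p.toList ∨ b ∈ q.toList := by
          intro b
          rcases hp with ⟨c, rfl⟩ | hp
          · rcases hq with ⟨d, rfl⟩ | hq
            · have hcd : c ≠ d := fun h' => hpq (by rw [h'])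
              simp only [FreeMonoid.toList_of, List.mem_singleton]
              cases b <;> cases c <;> cases d <;> simp_all
            · exact Or.inr (hq b)
          · exact Or.inl (hp b)
        refine M.sub_mem (Submodule.subset_span ⟨p * q, Or.inr fun b => ?_, rfl⟩)
          (Submodule.subset_span ⟨q * p, Or.inr fun b => ?_, rfl⟩)
        · rw [FreeMonoid.toList_mul, List.mem_append]; exact hboth b
        · rw [FreeMonoid.toList_mul, List.mem_append]; exact (hboth b).symm
    · intro Q _; rw [zero_mul, mul_zero, sub_zero]; exact M.zero_mem
    · intro P _; rw [zero_mul, mul_zero, sub_zero]; exact M.zero_mem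
    · intro P Q R _ _ _ h₁ h₂
      have := M.add_mem h₁ h₂
      convert this using 1
      rw [add_mul, mul_add]; abel
    · intro P Q R _ _ _ h₁ h₂
      have := M.add_mem h₁ h₂
      convert this using 1
      rw [add_mul, mul_add]; abel
    · intro c P Q _ _ h₁
      rw [smul_mul_assoc, mul_smul_comm, ← smul_sub]; exact M.smul_mem c h₁
    · intro c P Q _ _ h₁
      rw [smul_mul_assoc, mul_smul_comm, ← smul_sub]; exact M.smul_mem c h₁
  let S : LieSubalgebra Φ (L Φ) :=
    { (M.map (evalPair F).toLinearMap).comap (toU Φ : L Φ →ₗ[Φ] U Φ) with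
      lie_mem' := by
        rintro a b ⟨P, hP, hPa⟩ ⟨Q, hQ, hQb⟩
        refine ⟨P * Q - Q * P, hlie P hP Q hQ, ?_⟩
        change evalPair F P = toU Φ a at hPa
        change evalPair F Q = toU Φ b at hQb
        change evalPair F (P * Q - Q * P) = toU Φ ⁅a, b⁆
        rw [toU_lie, map_sub, map_mul, map_mul, hPa, hQb] }
  have hS : LieSubalgebra.lieSpan Φ (L Φ) (Set.range F) ≤ S := by
    rw [LieSubalgebra.lieSpan_le]
    rintro _ ⟨b, rfl⟩
    refine ⟨MonoidAlgebra.single (FreeMonoid.of b) 1,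
      Submodule.subset_span ⟨_, Or.inl ⟨b, rfl⟩, rfl⟩, ?_⟩
    change evalPair F (MonoidAlgebra.single (FreeMonoid.of b) 1) = toU Φ (F b)
    rw [evalPair, MonoidAlgebra.lift_single, one_smul, FreeMonoid.lift_eval_of]
  obtain ⟨P, hP, hPh⟩ := hS hh
  refine ⟨P, hPh, fun w hw => ?_⟩
  have hsupp : M ≤ (Finsupp.supported Φ Φ T).comap
      (MonoidAlgebra.coeffLinearEquiv Φ).toLinearMap := by
    rw [Submodule.span_le]
    rintro _ ⟨w, hw, rfl⟩
    exact Finsupp.single_mem_supported Φ 1 hw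
  exact hsupp hP (Finsupp.mem_support_iff.2 hw)

variable [IsDomain Φ]

/-- Two Lie elements with distinct leading words generate a free associative algebra, on which the
degree is at least the degree weighted by the degrees of the generators. -/
theorem weight_le_deg_evalPair {F : Bool → L Φ} (hF : ∀ b, F b ≠ 0)
    (hlm : lm (F true) ≠ lm (F false)) (w : FreeMonoid Bool) :
    ∀ P : MonoidAlgebra Φ (FreeMonoid Bool), P.coeff w ≠ 0 →
      evalPair F P ≠ 0 ∧ weight F w ≤ deg (evalPair F P) := by
  have tail_le : ∀ (b : Bool) (P : MonoidAlgebra Φ (FreeMonoid Bool)),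
      evalPair F (tail b P) ≠ 0 → evalPair F P ≠ 0 ∧
        (lm (F b)).1.length + deg (evalPair F (tail b P)) ≤ deg (evalPair F P) := by
    intro b P hb
    have hle : (lm (F b)).1.length + deg (evalPair F (tail b P)) ≤
        deg (toU Φ (F true) * evalPair F (tail true P) +
          toU Φ (F false) * evalPair F (tail false P)) := by
      cases b with
      | true => exact le_deg_toU_mul_add (hF _) (hF _) hlm _ hb
      | false =>
        rw [add_comm (toU Φ (F true) * _)]
        exact le_deg_toU_mul_add (hF _) (hF _) hlm.symm _ hb
    have hpos := FreeMagma.length_pos (lm (F b)).1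
    have hdeg : (lm (F b)).1.length + deg (evalPair F (tail b P)) ≤ deg (evalPair F P) := by
      rw [evalPair_eq F P, deg_single_one_add (by omega)]
      exact hle
    refine ⟨fun h0 => ?_, hdeg⟩
    rw [h0, deg_zero] at hdeg
    omega
  induction w using FreeMonoid.recOn with
  | one =>
    intro P hP
    refine ⟨?_, Nat.zero_le _⟩
    by_cases ht : evalPair F (tail true P) = 0
    · by_cases hf : evalPair F (tail false P) = 0
      · rw [evalPair_eq, ht, hf, mul_zero, mul_zero, add_zero, add_zero]
        exact MonoidAlgebra.single_ne_zero.2 hP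
      · exact (tail_le _ _ hf).1
    · exact (tail_le _ _ ht).1
  | of_mul b w ih =>
    intro P hP
    obtain ⟨h₁, h₂⟩ := ih (tail b P) hP
    obtain ⟨h₃, h₄⟩ := tail_le b P h₁
    refine ⟨h₃, le_trans ?_ h₄⟩
    rw [weight, FreeMonoid.toList_of_mul, List.map_cons, List.sum_cons]
    exact Nat.add_le_add_left h₂ _

/-- In the subalgebra generated by two elements with distinct leading words, the elements whose
leading word does not exceed the greater leading word of the generators are linear combinations of
the generators. -/
theorem exists_linear_of_lm_ne {F : Bool → L Φ} (hF : ∀ b, F b ≠ 0)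
    (hlm : lm (F true) ≠ lm (F false)) {h : L Φ}
    (hh : h ∈ LieSubalgebra.lieSpan Φ (L Φ) (Set.range F))
    (hle : lm h ≤ max (lm (F true)) (lm (F false))) :
    ∃ c d : Φ, h = c • F true + d • F false := by
  obtain ⟨P, hP, hsupp⟩ := exists_evalPair_eq hh
  have hP' : P = P.coeff (FreeMonoid.of true) • MonoidAlgebra.single (FreeMonoid.of true) 1 +
      P.coeff (FreeMonoid.of false) • MonoidAlgebra.single (FreeMonoid.of false) 1 := by
    classical
    ext w
    simp only [MonoidAlgebra.coeff_add, MonoidAlgebra.coeff_smul, MonoidAlgebra.coeff_single,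
      Finsupp.add_apply, Finsupp.smul_apply, smul_eq_mul]
    by_cases hw : ∃ b, w = FreeMonoid.of b
    · obtain ⟨b, rfl⟩ := hw
      have hne : FreeMonoid.of true ≠ FreeMonoid.of false := fun h' => by
        simpa using FreeMonoid.of_injective h'
      cases b
      · rw [Finsupp.single_eq_of_ne hne.symm, Finsupp.single_eq_same]; simp
      · rw [Finsupp.single_eq_of_ne hne, Finsupp.single_eq_same]; simp
    · push Not at hw
      rw [Finsupp.single_eq_of_ne (hw true), Finsupp.single_eq_of_ne (hw false), mul_zero,
        mul_zero, add_zero]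
      by_contra hcoeff
      rcases hsupp w hcoeff with ⟨b, hb⟩ | hall
      · exact hw b hb
      -- a word with both variables has degree greater than both generators
      · have h₁ := (weight_le_deg_evalPair hF hlm w P hcoeff).2
        rw [hP] at h₁
        have h₂ := h₁.trans (deg_toU_le h)
        have hlen : ∀ b, (lm (F b)).1.length < weight F w := by
          intro b
          have hsub : List.Subperm [b, !b] w.toList := by
            refine List.subperm_of_subset (by cases b <;> simp) ?_
            intro c _
            exact hall c
          obtain ⟨l, hl, hs⟩ := hsub
          have h₃ : ([b, !b].map fun b => (lm (F b)).1.length).sum ≤ weight F w := by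
            rw [← (hl.map _).sum_eq]
            exact (hs.map _).sum_le_sum fun _ _ => Nat.zero_le _
          have h₄ := FreeMagma.length_pos (lm (F !b)).1
          simp only [List.map_cons, List.map_nil, List.sum_cons, List.sum_nil] at h₃
          omega
        have h₅ := hlen true
        have h₆ := hlen false
        rcases le_max_iff.1 hle with h₇ | h₇
        · have := Word.length_le_of_le h₇
          omega
        · have := Word.length_le_of_le h₇
          omega
  refine ⟨P.coeff (FreeMonoid.of true), P.coeff (FreeMonoid.of false), toU_injective ?_⟩
  have hF' : ∀ b, evalPair F (MonoidAlgebra.single (FreeMonoid.of b) 1) = toU Φ (F b) := by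
    intro b
    rw [evalPair, MonoidAlgebra.lift_single, one_smul, FreeMonoid.lift_eval_of]
  rw [← hP, hP', map_add, map_smul, map_smul, map_add, map_smul, map_smul, hF', hF', ← hP']

end TwoGenerated

/-! ### Euclidean division of leading coefficients -/

section Euclid

variable {Φ : Type*} [CommRing Φ]

/-- The leading word of an element together with the norm of its leading coefficient, ordered
lexicographically. -/
def size (N : Φ → ℕ) (f : L Φ) : RegularWord ×ₗ ℕ := toLex (lm f, N (lc f))

theorem size_lt_iff {N : Φ → ℕ} {f g : L Φ} :
    size N f < size N g ↔ lm f < lm g ∨ lm f = lm g ∧ N (lc f) < N (lc g) :=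
  Prod.Lex.toLex_lt_toLex

theorem lm_le_of_size_le {N : Φ → ℕ} {f g : L Φ} (h : size N f ≤ size N g) : lm f ≤ lm g := by
  rcases Prod.Lex.toLex_le_toLex.1 h with h | h
  · exact h.le
  · exact h.1.le

/-- If two elements have the same leading word, then Euclidean division of the leading
coefficients decreases the one whose coefficient has the larger norm. -/
theorem exists_size_sub_smul_lt {N : Φ → ℕ} (hN : IsEuclideanNorm N) {a b : L Φ}
    (hab : lm a = lm b) (hle : N (lc b) ≤ N (lc a)) (hb : b ≠ 0)
    (hne : ∀ q : Φ, a - q • b ≠ 0) : ∃ q : Φ, size N (a - q • b) < size N a := by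
  obtain ⟨q, r, hqr, hr⟩ := hN.exists_div (lc a) (lc b) (lc_ne_zero hb)
  refine ⟨q, ?_⟩
  have hcoeff : regularCoeffs (a - q • b) (lm a) = r := by
    rw [regularCoeffs_sub, regularCoeffs_smul, Finsupp.sub_apply, Finsupp.smul_apply, smul_eq_mul]
    conv_lhs => rw [hab]
    change regularCoeffs a (lm b) - q * lc b = r
    rw [← hab]
    change lc a - q * lc b = r
    rw [hqr]; ring
  have hlm : lm (a - q • b) ≤ lm a := lm_sub_le le_rfl ((lm_smul_le _ _).trans hab.ge)
  rw [size_lt_iff]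
  rcases hlm.lt_or_eq with hlt | heq
  · exact Or.inl hlt
  · refine Or.inr ⟨heq, ?_⟩
    have hlc : lc (a - q • b) = r := by rw [lc, heq, hcoeff]
    rw [hlc]
    rcases hr with h0 | hlt
    · exact absurd (hlc.trans h0) (lc_ne_zero (hne q))
    · exact hlt.trans_le hle

variable [IsDomain Φ]

theorem norm_unit_mul {N : Φ → ℕ} (hN : IsEuclideanNorm N) {u a : Φ} (hu : IsUnit u)
    (ha : a ≠ 0) : N (u * a) = N a := by
  obtain ⟨u, rfl⟩ := hu
  refine le_antisymm ?_ ?_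
  · have := hN.le_mul (u * a) (↑u⁻¹) (mul_ne_zero u.ne_zero ha) u⁻¹.ne_zero
    rwa [mul_right_comm, Units.mul_inv, one_mul] at this
  · have := hN.le_mul a u ha u.ne_zero
    rwa [mul_comm] at this

theorem exists_linear_pair_of_lm_ne {a b h : L Φ} (ha : a ≠ 0) (hb : b ≠ 0) (hlm : lm a ≠ lm b)
    (hh : h ∈ LieSubalgebra.lieSpan Φ (L Φ) {a, b}) (hle : lm h ≤ max (lm a) (lm b)) :
    ∃ c d : Φ, h = c • a + d • b := by
  refine exists_linear_of_lm_ne (F := fun t => cond t a b) (fun t => by cases t <;> assumption)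
    hlm ?_ hle
  refine LieSubalgebra.lieSpan_mono ?_ hh
  rintro _ (rfl | rfl)
  · exact ⟨true, rfl⟩
  · exact ⟨false, rfl⟩

/-- In the subalgebra generated by two linearly independent elements, the elements whose leading
word does not exceed those of both generators are linear combinations of the generators. The
Euclidean algorithm reduces this to the case of distinct leading words. -/
theorem exists_linear_pair {N : Φ → ℕ} (hN : IsEuclideanNorm N) {a b h : L Φ}
    (hab : ∀ c d : Φ, c • a + d • b = 0 → c = 0 ∧ d = 0)
    (hh : h ∈ LieSubalgebra.lieSpan Φ (L Φ) {a, b}) (hle : lm h ≤ max (lm a) (lm b)) :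
    ∃ c d : Φ, h = c • a + d • b := by
  have hne : ∀ {a b : L Φ}, (∀ c d : Φ, c • a + d • b = 0 → c = 0 ∧ d = 0) → a ≠ 0 := by
    rintro a b hab rfl
    exact one_ne_zero (hab 1 0 (by simp)).1
  have hsymm : ∀ {a b : L Φ}, (∀ c d : Φ, c • a + d • b = 0 → c = 0 ∧ d = 0) →
      ∀ c d : Φ, c • b + d • a = 0 → c = 0 ∧ d = 0 :=
    fun hab c d h0 => (hab d c (by rw [add_comm]; exact h0)).symm
  induction hn : N (lc a) + N (lc b) using Nat.strong_induction_on generalizing a b with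
  | _ n ih =>
  have ha₀ := hne hab
  have hb₀ := hne (hsymm hab)
  by_cases hlm : lm a = lm b
  swap
  · exact exists_linear_pair_of_lm_ne ha₀ hb₀ hlm hh hle
  have main : ∀ {a b : L Φ}, (∀ c d : Φ, c • a + d • b = 0 → c = 0 ∧ d = 0) →
      h ∈ LieSubalgebra.lieSpan Φ (L Φ) {a, b} → lm h ≤ max (lm a) (lm b) →
      N (lc a) + N (lc b) = n → lm a = lm b → N (lc b) ≤ N (lc a) →
      ∃ c d : Φ, h = c • a + d • b := by
    intro a b hab hh hle hn hlm hN'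
    have hind : ∀ q c d : Φ, c • (a - q • b) + d • b = 0 → c = 0 ∧ d = 0 := by
      intro q c d h0
      have h1 : c • a + (d - c * q) • b = 0 := by rw [← h0]; module
      obtain ⟨hc, hd⟩ := hab _ _ h1
      rw [hc, zero_mul, sub_zero] at hd
      exact ⟨hc, hd⟩
    have hb₀ := hne (hsymm hab)
    obtain ⟨q, hq⟩ := exists_size_sub_smul_lt hN hlm hN' hb₀ fun q => hne (hind q)
    have hh' : h ∈ LieSubalgebra.lieSpan Φ (L Φ) {a - q • b, b} := by
      refine LieSubalgebra.lieSpan_le.2 ?_ hh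
      have h₁ : a - q • b ∈ LieSubalgebra.lieSpan Φ (L Φ) {a - q • b, b} :=
        LieSubalgebra.subset_lieSpan (by simp)
      have h₂ : b ∈ LieSubalgebra.lieSpan Φ (L Φ) {a - q • b, b} :=
        LieSubalgebra.subset_lieSpan (by simp)
      rintro _ (rfl | rfl)
      · have := add_mem h₁ (SMulMemClass.smul_mem q h₂)
        rwa [sub_add_cancel] at this
      · exact h₂
    have hle' : lm h ≤ max (lm (a - q • b)) (lm b) := by
      refine le_max_of_le_right (hle.trans ?_)
      rw [hlm, max_self]
    have hlin : ∃ c d : Φ, h = c • (a - q • b) + d • b := by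
      rcases size_lt_iff.1 hq with hlt | ⟨-, hlt⟩
      · exact exists_linear_pair_of_lm_ne (hne (hind q)) hb₀ (by rw [← hlm]; exact hlt.ne) hh' hle'
      · exact ih _ (by omega) (hind q) hh' hle' rfl
    obtain ⟨c, d, hcd⟩ := hlin
    exact ⟨c, d - c * q, by rw [hcd]; module⟩
  rcases le_total (N (lc b)) (N (lc a)) with hN' | hN'
  · exact main hab hh hle hn hlm hN'
  · rw [Set.pair_comm] at hh
    rw [max_comm] at hle
    obtain ⟨c, d, hcd⟩ := main (hsymm hab) hh hle (by omega) hlm.symm hN'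
    exact ⟨d, c, by rw [hcd, add_comm]⟩

/-- The leading word of a linear combination of elements with distinct leading words is attained
by a term with a nonzero coefficient. -/
theorem exists_lm_sum_eq {ι : Type*} [Fintype ι] {f : ι → L Φ} (hf : ∀ i, f i ≠ 0)
    (hinj : Function.Injective fun i => lm (f i)) {c : ι → Φ} (hc : ∃ i, c i ≠ 0) :
    ∃ i, c i ≠ 0 ∧ lm (∑ j, c j • f j) = lm (f i) ∧ lc (∑ j, c j • f j) = c i * lc (f i) ∧
      ∀ j, c j ≠ 0 → lm (f j) ≤ lm (f i) := by
  classical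
  obtain ⟨i₀, hi₀⟩ := hc
  obtain ⟨i, hi, hmax⟩ := Finset.exists_max_image (Finset.univ.filter fun i => c i ≠ 0)
    (fun i => lm (f i)) ⟨i₀, by simpa using hi₀⟩
  have hi' : c i ≠ 0 := by simpa using hi
  have hmax' : ∀ j, c j ≠ 0 → lm (f j) ≤ lm (f i) := fun j hj => hmax j (by simpa using hj)
  have hsum : ∀ v, regularCoeffs (∑ j, c j • f j) v = ∑ j, c j * regularCoeffs (f j) v := by
    intro v
    have : regularCoeffs (∑ j, c j • f j) = ∑ j, c j • regularCoeffs (f j) := by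
      apply comb_injective
      rw [comb_regularCoeffs, map_sum]
      simp only [map_smul, comb_regularCoeffs]
    rw [this, Finsupp.finsetSum_apply]
    rfl
  have hcoeff : regularCoeffs (∑ j, c j • f j) (lm (f i)) = c i * lc (f i) := by
    rw [hsum, Finset.sum_eq_single i]
    · rfl
    · intro j _ hji
      by_cases hj : c j = 0
      · rw [hj, zero_mul]
      · rw [regularCoeffs_eq_zero_of_lm_lt, mul_zero]
        exact lt_of_le_of_ne (hmax' j hj) fun h => hji (hinj h)
    · intro h; exact absurd (Finset.mem_univ i) h
  have hlm : lm (∑ j, c j • f j) = lm (f i) := by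
    refine lm_eq_of_coeff ?_ ?_
    · rw [hcoeff]; exact mul_ne_zero hi' (lc_ne_zero (hf i))
    · rw [lm_le_iff]
      intro v hv
      rw [hsum]
      refine Finset.sum_eq_zero fun j _ => ?_
      by_cases hj : c j = 0
      · rw [hj, zero_mul]
      · rw [regularCoeffs_eq_zero_of_lm_lt ((hmax' j hj).trans_lt hv), mul_zero]
  exact ⟨i, hi', hlm, by rw [lc, hlm, hcoeff], hmax'⟩

end Euclid

/-! ### The index of a triple -/

section Index

theorem sortedIndex_comm₁₂ (a b c : RegularWord) (n : ℕ) :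
    sortedIndex a b c n = sortedIndex b a c n := by
  simp only [sortedIndex]
  rw [max_left_comm, min_comm a b, max_comm a b, min_left_comm]

theorem sortedIndex_comm₂₃ (a b c : RegularWord) (n : ℕ) :
    sortedIndex a b c n = sortedIndex a c b n := by
  have h : max (min a b) (min (max a b) c) = max (min a c) (min (max a c) b) := by
    rcases le_total a b with h₁ | h₁ <;> rcases le_total a c with h₂ | h₂ <;>
      rcases le_total b c with h₃ | h₃ <;> simp [h₁, h₂, h₃] <;> order
  simp only [sortedIndex]
  rw [max_comm b c, min_comm b c, h]

theorem sortedIndex_lt {a a' : RegularWord} {n n' : ℕ} (b c : RegularWord)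
    (h : a' < a ∨ a' = a ∧ n' < n) : sortedIndex a' b c n' < sortedIndex a b c n := by
  simp only [sortedIndex, mkIndex, Prod.Lex.toLex_lt_toLex]
  rcases h with h | ⟨rfl, h⟩
  · simp only [max_def, min_def]
    grind
  · exact Or.inr ⟨rfl, Or.inr ⟨rfl, Or.inr ⟨rfl, h⟩⟩⟩

variable {Φ : Type*} [CommRing Φ]

/-- The index of a triple of elements; `D N φ` is the index of the components of `φ`. -/
def index (N : Φ → ℕ) (f : Fin 3 → L Φ) : IndexType :=
  sortedIndex (lm (f 0)) (lm (f 1)) (lm (f 2)) (N (lc (f 0)) + N (lc (f 1)) + N (lc (f 2)))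

theorem index_comp_perm (N : Φ → ℕ) (f : Fin 3 → L Φ) (σ : Equiv.Perm (Fin 3)) :
    index N (f ∘ σ) = index N f := by
  have hsum : N (lc (f (σ 0))) + N (lc (f (σ 1))) + N (lc (f (σ 2))) =
      N (lc (f 0)) + N (lc (f 1)) + N (lc (f 2)) := by
    have := Equiv.sum_comp σ fun i => N (lc (f i))
    rwa [Fin.sum_univ_three, Fin.sum_univ_three] at this
  simp only [index, Function.comp_apply]
  rw [hsum]
  generalize N (lc (f 0)) + N (lc (f 1)) + N (lc (f 2)) = n
  have h₀₁ : σ 0 ≠ σ 1 := σ.injective.ne (by decide)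
  have h₀₂ : σ 0 ≠ σ 2 := σ.injective.ne (by decide)
  have h₁₂ : σ 1 ≠ σ 2 := σ.injective.ne (by decide)
  generalize σ 0 = i at *
  generalize σ 1 = j at *
  generalize σ 2 = k at *
  generalize hg : (fun i => lm (f i)) = g
  have hg' : ∀ i, lm (f i) = g i := fun i => congrFun hg i
  simp only [hg']
  clear hg hg' hsum
  have h₁ := fun a b c => sortedIndex_comm₁₂ a b c n
  have h₂ := fun a b c => sortedIndex_comm₂₃ a b c n
  fin_cases i <;> fin_cases j <;> fin_cases k <;> simp_all <;> grind

theorem index_lt_of_size_lt {N : Φ → ℕ} {f g : Fin 3 → L Φ} (i : Fin 3)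
    (hi : size N (g i) < size N (f i)) (hj : ∀ j, j ≠ i → g j = f j) :
    index N g < index N f := by
  rw [size_lt_iff] at hi
  fin_cases i
  · have h₁ := hj 1 (by decide)
    have h₂ := hj 2 (by decide)
    simp only [index, h₁, h₂]
    exact sortedIndex_lt _ _ (hi.imp id fun h => ⟨h.1, by have := h.2; simp at this; omega⟩)
  · have h₁ := hj 0 (by decide)
    have h₂ := hj 2 (by decide)
    simp only [index, h₁, h₂]
    rw [sortedIndex_comm₁₂, sortedIndex_comm₁₂ (lm (f 0))]
    exact sortedIndex_lt _ _ (hi.imp id fun h => ⟨h.1, by have := h.2; simp at this; omega⟩)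
  · have h₁ := hj 0 (by decide)
    have h₂ := hj 1 (by decide)
    simp only [index, h₁, h₂]
    rw [sortedIndex_comm₂₃ _ _ (lm (g 2)), sortedIndex_comm₂₃ _ _ (lm (f 2)),
      sortedIndex_comm₁₂ _ (lm (g 2)), sortedIndex_comm₁₂ _ (lm (f 2))]
    exact sortedIndex_lt _ _ (hi.imp id fun h => ⟨h.1, by have := h.2; simp at this; omega⟩)

theorem index_eq_of_size_eq {N : Φ → ℕ} {f g : Fin 3 → L Φ}
    (h : ∀ i, size N (g i) = size N (f i)) : index N g = index N f := by
  have h₁ : ∀ i, lm (g i) = lm (f i) := fun i => congrArg (fun s => (ofLex s).1) (h i)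
  have h₂ : ∀ i, N (lc (g i)) = N (lc (f i)) := fun i => congrArg (fun s => (ofLex s).2) (h i)
  simp only [index, h₁, h₂]

theorem size_le_of_index_le {N : Φ → ℕ} {f g : Fin 3 → L Φ} (i : Fin 3)
    (h : index N g ≤ index N f) (hj : ∀ j, j ≠ i → g j = f j) : size N (g i) ≤ size N (f i) := by
  by_contra! hlt
  exact absurd (index_lt_of_size_lt i hlt fun j hji => (hj j hji).symm) (not_lt.2 h)

theorem size_lt_of_index_lt {N : Φ → ℕ} {f g : Fin 3 → L Φ} (i : Fin 3)
    (h : index N g < index N f) (hj : ∀ j, j ≠ i → g j = f j) : size N (g i) < size N (f i) := by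
  refine lt_of_le_of_ne (size_le_of_index_le i h.le hj) fun heq => ?_
  refine h.ne (index_eq_of_size_eq fun j => ?_)
  by_cases hji : j = i
  · rw [hji, heq]
  · rw [hj j hji]

end Index

/-! ### Elementary transformations -/

section Elementary

variable {Φ : Type*} [CommRing Φ]

/-- The subalgebra generated by the components of a triple other than the `i`-th one. -/
def others (i : Fin 3) (f : Fin 3 → L Φ) : LieSubalgebra Φ (L Φ) :=
  LieSubalgebra.lieSpan Φ (L Φ) {k | ∃ j, j ≠ i ∧ k = f j}

theorem mem_others {i j : Fin 3} (f : Fin 3 → L Φ) (h : j ≠ i) : f j ∈ others i f :=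
  LieSubalgebra.subset_lieSpan ⟨j, h, rfl⟩

theorem others_congr {i : Fin 3} {f g : Fin 3 → L Φ} (h : ∀ j, j ≠ i → g j = f j) :
    others i g = others i f := by
  have : {k | ∃ j, j ≠ i ∧ k = g j} = {k | ∃ j, j ≠ i ∧ k = f j} := by
    ext k
    constructor
    · rintro ⟨j, hj, rfl⟩; exact ⟨j, hj, h j hj⟩
    · rintro ⟨j, hj, rfl⟩; exact ⟨j, hj, (h j hj).symm⟩
  rw [others, this, others]

theorem elementaryTransformation_iff {f g : Fin 3 → L Φ} :
    ElementaryTransformation f g ↔ ∃ (i : Fin 3) (α : Φ) (h : L Φ), IsUnit α ∧ h ∈ others i f ∧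
      g i = α • f i + h ∧ ∀ j, j ≠ i → g j = f j := by
  constructor
  · rintro ⟨i, α, h, hα, hh, rfl⟩
    exact ⟨i, α, h, hα, hh, Function.update_self _ _ _,
      fun j hj => Function.update_of_ne hj _ _⟩
  · rintro ⟨i, α, h, hα, hh, hi, hj⟩
    refine ⟨i, α, h, hα, hh, ?_⟩
    ext1 j
    by_cases hji : j = i
    · subst hji; rw [Function.update_self, hi]
    · rw [Function.update_of_ne hji, hj j hji]

/-- Two triples which are obtained from a third one by elementary transformations of the same
component are connected by an elementary transformation. -/
theorem elementaryTransformation_of_same {f g g' : Fin 3 → L Φ} {i : Fin 3} {α β : Φ} {h k : L Φ}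
    (hα : IsUnit α) (hβ : IsUnit β) (hh : h ∈ others i f) (hk : k ∈ others i f)
    (hg : g i = α • f i + h) (hg' : g' i = β • f i + k) (hj : ∀ j, j ≠ i → g j = f j)
    (hj' : ∀ j, j ≠ i → g' j = f j) : ElementaryTransformation g g' := by
  obtain ⟨u, rfl⟩ := hα
  rw [elementaryTransformation_iff]
  refine ⟨i, β * ↑u⁻¹, k - (β * ↑u⁻¹ : Φ) • h, hβ.mul u⁻¹.isUnit, ?_, ?_, ?_⟩
  · rw [others_congr hj]
    exact sub_mem hk (SMulMemClass.smul_mem _ hh)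
  · have h₁ : (β * ↑u⁻¹ * ↑u : Φ) = β := by rw [mul_assoc, Units.inv_mul, mul_one]
    rw [hg', hg, smul_add, smul_smul, h₁]
    abel
  · intro j hji
    rw [hj j hji, hj' j hji]

theorem ElementaryTransformation.symm {f g : Fin 3 → L Φ} (h : ElementaryTransformation f g) :
    ElementaryTransformation g f := by
  obtain ⟨i, α, k, hα, hk, hi, hj⟩ := elementaryTransformation_iff.1 h
  exact elementaryTransformation_of_same hα isUnit_one hk (zero_mem _) hi
    (by rw [one_smul, add_zero]) hj fun _ _ => rfl

theorem ElementaryTransformation.comp_perm {f g : Fin 3 → L Φ} (h : ElementaryTransformation f g)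
    (σ : Equiv.Perm (Fin 3)) : ElementaryTransformation (f ∘ σ) (g ∘ σ) := by
  obtain ⟨i, α, k, hα, hk, hi, hj⟩ := elementaryTransformation_iff.1 h
  refine elementaryTransformation_iff.2 ⟨σ.symm i, α, k, hα, ?_, ?_, ?_⟩
  · refine LieSubalgebra.lieSpan_mono ?_ hk
    rintro _ ⟨j, hji, rfl⟩
    exact ⟨σ.symm j, σ.symm.injective.ne hji, by simp⟩
  · simpa using hi
  · intro j hji
    exact hj _ fun h' => hji (by rw [← h', Equiv.symm_apply_apply])

/-- `f` is the triple of components of an automorphism. -/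
def IsAutTriple (f : Fin 3 → L Φ) : Prop := ∃ φ : Aut Φ, components φ = f

theorem lieSpan_map_mem {φ : L Φ →ₗ⁅Φ⁆ L Φ} {s t : Set (L Φ)} (hst : ∀ y ∈ s, φ y ∈ t) {h : L Φ}
    (hh : h ∈ LieSubalgebra.lieSpan Φ (L Φ) s) : φ h ∈ LieSubalgebra.lieSpan Φ (L Φ) t := by
  have : LieSubalgebra.lieSpan Φ (L Φ) s ≤ (LieSubalgebra.lieSpan Φ (L Φ) t).comap φ := by
    rw [LieSubalgebra.lieSpan_le]
    exact fun y hy => LieSubalgebra.subset_lieSpan (hst y hy)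
  exact this hh

theorem components_mul (φ ψ : Aut Φ) (i : Fin 3) : components (φ * ψ) i = φ (ψ (x Φ i)) := rfl

theorem map_mem_others (φ : Aut Φ) {i : Fin 3} {h : L Φ} (hh : h ∈ others i (x Φ)) :
    φ h ∈ others i (components φ) := by
  refine lieSpan_map_mem (φ := φ.toLieHom) ?_ hh
  rintro _ ⟨j, hj, rfl⟩
  exact ⟨j, hj, rfl⟩

/-- Multiplication by an elementary automorphism on the right is an elementary transformation of
the components. -/
theorem elementaryTransformation_mul (φ : Aut Φ) {δ : Aut Φ} (hδ : IsElementary δ) :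
    ElementaryTransformation (components φ) (components (φ * δ)) := by
  obtain ⟨i, α, h, hα, hh, hi, hj⟩ := hδ
  refine elementaryTransformation_iff.2 ⟨i, α, φ h, hα, map_mem_others φ hh, ?_, ?_⟩
  · rw [components_mul, hi, map_add, map_smul]; rfl
  · intro j hji
    rw [components_mul, hj j hji]; rfl

/-- The automorphism which replaces the generator `x i` by `α x i + h`, with `h` in the subalgebra
generated by the other generators. -/
theorem exists_elementary_aut (i : Fin 3) (α : Φ) (hα : IsUnit α) {h : L Φ}
    (hh : h ∈ others i (x Φ)) :
    ∃ δ : Aut Φ, δ (x Φ i) = α • x Φ i + h ∧ ∀ j, j ≠ i → δ (x Φ j) = x Φ j := by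
  obtain ⟨u, rfl⟩ := hα
  have fix : ∀ y : L Φ, FreeLieAlgebra.lift Φ (Function.update (x Φ) i y) h = h := by
    intro y
    refine LieSubalgebra.lieSpan_induction Φ
      (p := fun k _ => FreeLieAlgebra.lift Φ (Function.update (x Φ) i y) k = k) ?_ ?_ ?_ ?_ ?_ hh
    · rintro _ ⟨j, hj, rfl⟩
      exact (FreeLieAlgebra.lift_of_apply _ j).trans (Function.update_of_ne hj _ _)
    · exact map_zero _
    · intro a b _ _ ha hb; rw [map_add, ha, hb]
    · intro c a _ ha; rw [map_smul, ha]
    · intro a b _ _ ha hb; rw [LieHom.map_lie, ha, hb]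
  let A := FreeLieAlgebra.lift Φ (Function.update (x Φ) i ((u : Φ) • x Φ i + h))
  let B := FreeLieAlgebra.lift Φ (Function.update (x Φ) i ((↑u⁻¹ : Φ) • (x Φ i - h)))
  have hA : ∀ j, A (x Φ j) = Function.update (x Φ) i ((u : Φ) • x Φ i + h) j :=
    FreeLieAlgebra.lift_of_apply _
  have hB : ∀ j, B (x Φ j) = Function.update (x Φ) i ((↑u⁻¹ : Φ) • (x Φ i - h)) j :=
    FreeLieAlgebra.lift_of_apply _
  have hAh : A h = h := fix _
  have hBh : B h = h := fix _
  have hBA : B.comp A = LieHom.id := by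
    apply FreeLieAlgebra.hom_ext
    intro j
    change B (A (x Φ j)) = x Φ j
    by_cases hj : j = i
    · subst hj
      rw [hA, Function.update_self, map_add, map_smul, hBh, hB, Function.update_self, smul_smul,
        Units.mul_inv, one_smul, sub_add_cancel]
    · rw [hA, Function.update_of_ne hj, hB, Function.update_of_ne hj]
  have hAB : A.comp B = LieHom.id := by
    apply FreeLieAlgebra.hom_ext
    intro j
    change A (B (x Φ j)) = x Φ j
    by_cases hj : j = i
    · subst hj
      rw [hB, Function.update_self, map_smul, map_sub, hAh, hA, Function.update_self,
        add_sub_cancel_right, smul_smul, Units.inv_mul, one_smul]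
    · rw [hB, Function.update_of_ne hj, hA, Function.update_of_ne hj]
  let δ : Aut Φ := { A with
    invFun := B
    left_inv := fun y => congrArg (fun G : L Φ →ₗ⁅Φ⁆ L Φ => G y) hBA
    right_inv := fun y => congrArg (fun G : L Φ →ₗ⁅Φ⁆ L Φ => G y) hAB }
  refine ⟨δ, ?_, fun j hj => ?_⟩
  · exact (hA i).trans (Function.update_self _ _ _)
  · exact (hA j).trans (Function.update_of_ne hj _ _)

theorem IsAutTriple.elementaryTransformation {f g : Fin 3 → L Φ} (hf : IsAutTriple f)
    (h : ElementaryTransformation f g) : IsAutTriple g := by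
  obtain ⟨φ, rfl⟩ := hf
  obtain ⟨i, α, k, hα, hk, hi, hj⟩ := elementaryTransformation_iff.1 h
  have hk' : φ.symm k ∈ others i (x Φ) := by
    refine lieSpan_map_mem (φ := φ.symm.toLieHom) ?_ hk
    rintro _ ⟨j, hj, rfl⟩
    exact ⟨j, hj, φ.symm_apply_apply _⟩
  obtain ⟨δ, hδi, hδj⟩ := exists_elementary_aut i α hα hk'
  refine ⟨φ * δ, ?_⟩
  ext1 j
  rw [components_mul]
  by_cases hji : j = i
  · subst hji
    rw [hδi, hi, map_add, map_smul, LieEquiv.apply_symm_apply]; rfl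
  · rw [hδj j hji, hj j hji]; rfl

theorem IsAutTriple.comp_perm {f : Fin 3 → L Φ} (hf : IsAutTriple f) (σ : Equiv.Perm (Fin 3)) :
    IsAutTriple (f ∘ σ) := by
  obtain ⟨φ, rfl⟩ := hf
  let P : Equiv.Perm (Fin 3) → (L Φ →ₗ⁅Φ⁆ L Φ) := fun τ => FreeLieAlgebra.lift Φ (x Φ ∘ τ)
  have hP : ∀ τ j, P τ (x Φ j) = x Φ (τ j) := fun τ j => FreeLieAlgebra.lift_of_apply _ j
  have hinv : ∀ τ : Equiv.Perm (Fin 3), (P τ.symm).comp (P τ) = LieHom.id := by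
    intro τ
    apply FreeLieAlgebra.hom_ext
    intro j
    change P τ.symm (P τ (x Φ j)) = x Φ j
    rw [hP, hP, Equiv.symm_apply_apply]
  let δ : Aut Φ := { P σ with
    invFun := P σ.symm
    left_inv := fun y => congrArg (fun G : L Φ →ₗ⁅Φ⁆ L Φ => G y) (hinv σ)
    right_inv := fun y => congrArg (fun G : L Φ →ₗ⁅Φ⁆ L Φ => G y) (hinv σ.symm) }
  refine ⟨φ * δ, ?_⟩
  ext1 j
  exact congrArg φ (hP σ j)

theorem linearIndependent_x : LinearIndependent Φ (x Φ) := by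
  have h : LinearIndependent Φ fun v : RegularWord => wordElement Φ v.1 := comb_injective
  refine h.comp letter fun i j hij => ?_
  exact (List.cons.inj (congrArg (fun v : RegularWord => foliage v.1) hij)).1

theorem IsAutTriple.linearIndependent {f : Fin 3 → L Φ} (hf : IsAutTriple f) :
    LinearIndependent Φ f := by
  obtain ⟨φ, rfl⟩ := hf
  exact linearIndependent_x.map' φ.toLinearEquiv.toLinearMap
    (LinearMap.ker_eq_bot.2 φ.injective)

theorem IsAutTriple.ne_zero [IsDomain Φ] {f : Fin 3 → L Φ} (hf : IsAutTriple f) (i : Fin 3) :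
    f i ≠ 0 := hf.linearIndependent.ne_zero i

theorem IsAutTriple.pair_independent {f : Fin 3 → L Φ} (hf : IsAutTriple f) {i j : Fin 3}
    (hij : i ≠ j) (c d : Φ) (h : c • f i + d • f j = 0) : c = 0 ∧ d = 0 :=
  (LinearIndepOn.pair_iff f hij).1 (hf.linearIndependent.linearIndepOn _) c d h

theorem exists_third {i j : Fin 3} (hij : i ≠ j) :
    ∃ k, k ≠ i ∧ k ≠ j ∧ ∀ l, l = i ∨ l = j ∨ l = k := by
  revert i j; decide

theorem others_eq {i j k : Fin 3} (hji : j ≠ i) (hki : k ≠ i) (hall : ∀ l, l = i ∨ l = j ∨ l = k)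
    (f : Fin 3 → L Φ) : others i f = LieSubalgebra.lieSpan Φ (L Φ) {f j, f k} := by
  have : {y | ∃ l, l ≠ i ∧ y = f l} = {f j, f k} := by
    ext y
    constructor
    · rintro ⟨l, hl, rfl⟩
      rcases hall l with h | rfl | rfl
      · exact absurd h hl
      · exact Or.inl rfl
      · exact Or.inr rfl
    · rintro (rfl | rfl)
      · exact ⟨j, hji, rfl⟩
      · exact ⟨k, hki, rfl⟩
  rw [others, this]

/-- A linear elementary transformation does not change the span of the components. -/
theorem span_range_eq {f g : Fin 3 → L Φ} {i j k : Fin 3} (hji : j ≠ i) (hki : k ≠ i)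
    {α c d : Φ} (hα : IsUnit α) (hi : g i = α • f i + (c • f j + d • f k))
    (hj : ∀ j, j ≠ i → g j = f j) :
    Submodule.span Φ (Set.range g) = Submodule.span Φ (Set.range f) := by
  have hmem : ∀ (f : Fin 3 → L Φ) (l : Fin 3), f l ∈ Submodule.span Φ (Set.range f) :=
    fun f l => Submodule.subset_span ⟨l, rfl⟩
  refine le_antisymm (Submodule.span_le.2 ?_) (Submodule.span_le.2 ?_)
  · rintro _ ⟨l, rfl⟩
    by_cases hl : l = i
    · subst hl
      rw [SetLike.mem_coe, hi]
      exact add_mem (Submodule.smul_mem _ _ (hmem f l)) (add_mem (Submodule.smul_mem _ _ (hmem f j))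
        (Submodule.smul_mem _ _ (hmem f k)))
    · rw [hj l hl]; exact hmem f l
  · rintro _ ⟨l, rfl⟩
    by_cases hl : l = i
    · subst hl
      obtain ⟨u, rfl⟩ := hα
      have : f l = (↑u⁻¹ : Φ) • (g l - (c • g j + d • g k)) := by
        rw [hi, hj j hji, hj k hki, add_sub_cancel_right, smul_smul, Units.inv_mul, one_smul]
      rw [SetLike.mem_coe, this]
      exact Submodule.smul_mem _ _ (sub_mem (hmem g l) (add_mem
        (Submodule.smul_mem _ _ (hmem g j)) (Submodule.smul_mem _ _ (hmem g k))))
    · rw [← hj l hl]; exact hmem g l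

end Elementary

/-! ### Reduced bases of a lattice -/

section Lattice

variable {Φ : Type*} [CommRing Φ]

/-- A chain of elementary transformations each of which decreases the index. -/
def Descends (N : Φ → ℕ) : (Fin 3 → L Φ) → (Fin 3 → L Φ) → Prop :=
  Relation.ReflTransGen fun f g => ElementaryTransformation f g ∧ index N g < index N f

theorem Descends.index_le {N : Φ → ℕ} {f g : Fin 3 → L Φ} (h : Descends N f g) :
    index N g ≤ index N f := by
  induction h with
  | refl => exact le_rfl
  | tail _ h ih => exact h.2.le.trans ih

/-- The triples from which chains of elementary transformations decreasing the index lead to an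
index at most `b`. -/
inductive Simple (N : Φ → ℕ) (b : IndexType) : (Fin 3 → L Φ) → Prop
  | of_le {f : Fin 3 → L Φ} (h : index N f ≤ b) : Simple N b f
  | step {f g : Fin 3 → L Φ} (h : ElementaryTransformation f g) (hlt : index N g < index N f)
      (hg : Simple N b g) : Simple N b f

theorem Simple.comp_perm {N : Φ → ℕ} {b : IndexType} {f : Fin 3 → L Φ} (hf : Simple N b f)
    (σ : Equiv.Perm (Fin 3)) : Simple N b (f ∘ σ) := by
  induction hf with
  | of_le h => exact .of_le (by rwa [index_comp_perm])
  | step h hlt _ ih =>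
    exact .step (h.comp_perm σ) (by rwa [index_comp_perm, index_comp_perm]) ih

theorem Simple.of_descends {N : Φ → ℕ} {b : IndexType} {f g : Fin 3 → L Φ}
    (h : Descends N f g) (hg : Simple N b g) : Simple N b f := by
  induction h using Relation.ReflTransGen.head_induction_on with
  | refl => exact hg
  | head h _ ih => exact .step h.1 h.2 ih

/-- Elementary transformations of triples of index less than `d` preserve simplicity. -/
def PreservedBelow (N : Φ → ℕ) (b d : IndexType) : Prop :=
  ∀ f g : Fin 3 → L Φ, IsAutTriple f → Simple N b f → ElementaryTransformation f g →
    index N f < d → Simple N b g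

theorem PreservedBelow.of_descends {N : Φ → ℕ} {b d : IndexType} (hd : PreservedBelow N b d)
    {f g : Fin 3 → L Φ} (h : Descends N f g) (haut : IsAutTriple f) (hf : Simple N b f)
    (hlt : index N f < d) : Simple N b g := by
  induction h using Relation.ReflTransGen.head_induction_on with
  | refl => exact hf
  | head h _ ih =>
    exact ih (haut.elementaryTransformation h.1) (hd _ _ haut hf h.1 hlt) (h.2.trans hlt)

theorem exists_perm_strictAnti {f : Fin 3 → L Φ} (hinj : Function.Injective fun i => lm (f i)) :
    ∃ σ : Equiv.Perm (Fin 3), StrictAnti fun i => lm ((f ∘ σ) i) := by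
  refine ⟨Tuple.sort fun i => OrderDual.toDual (lm (f i)), ?_⟩
  have hmono := Tuple.monotone_sort fun i => OrderDual.toDual (lm (f i))
  have hanti : Antitone fun i => lm ((f ∘ Tuple.sort fun i => OrderDual.toDual (lm (f i))) i) :=
    fun i j hij => hmono hij
  exact hanti.strictAnti_of_injective (hinj.comp (Equiv.injective _))

theorem lm_le_of_eq_add {N : Φ → ℕ} {α : Φ} {a a' h : L Φ} (ha' : a' = α • a + h)
    (hle : size N a' ≤ size N a) : lm h ≤ lm a := by
  have : h = a' - α • a := by rw [ha']; abel
  rw [this]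
  exact lm_sub_le (lm_le_of_size_le hle) (lm_smul_le _ _)

variable [IsDomain Φ]

/-- If two components have the same leading word, then the Euclidean algorithm yields a linear
elementary transformation which decreases the index. -/
theorem exists_reduction {N : Φ → ℕ} (hN : IsEuclideanNorm N) {f : Fin 3 → L Φ}
    (hf : IsAutTriple f) (hinj : ¬ Function.Injective fun i => lm (f i)) :
    ∃ g, ElementaryTransformation f g ∧ index N g < index N f ∧
      Submodule.span Φ (Set.range g) = Submodule.span Φ (Set.range f) := by
  have main : ∀ i j : Fin 3, i ≠ j → lm (f i) = lm (f j) → N (lc (f j)) ≤ N (lc (f i)) →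
      ∃ g, ElementaryTransformation f g ∧ index N g < index N f ∧
        Submodule.span Φ (Set.range g) = Submodule.span Φ (Set.range f) := by
    intro i j hij hlm hle
    obtain ⟨q, hq⟩ := exists_size_sub_smul_lt hN hlm hle (hf.ne_zero j) fun q h0 =>
      one_ne_zero (hf.pair_independent hij 1 (-q) (by rw [← h0]; module)).1
    have hi : Function.update f i (f i - q • f j) i = (1 : Φ) • f i + -q • f j := by
      rw [Function.update_self]; module
    refine ⟨Function.update f i (f i - q • f j), ?_, ?_, ?_⟩
    · exact elementaryTransformation_iff.2 ⟨i, 1, -q • f j, isUnit_one,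
        SMulMemClass.smul_mem _ (mem_others f hij.symm), hi,
        fun l hl => Function.update_of_ne hl _ _⟩
    · exact index_lt_of_size_lt i (by rw [Function.update_self]; exact hq)
        fun l hl => Function.update_of_ne hl _ _
    · exact span_range_eq (j := j) (k := j) (c := -q) (d := 0) hij.symm hij.symm isUnit_one
        (by rw [hi, zero_smul, add_zero]) fun l hl => Function.update_of_ne hl _ _
  simp only [Function.Injective, not_forall] at hinj
  obtain ⟨i, j, hlm, hij⟩ := hinj
  rcases le_total (N (lc (f j))) (N (lc (f i))) with h | h
  · exact main i j hij hlm h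
  · exact main j i (Ne.symm hij) hlm.symm h

/-- Repeated Euclidean reductions end in a basis of the same lattice with distinct leading words. -/
theorem exists_reduced {N : Φ → ℕ} (hN : IsEuclideanNorm N) (f : Fin 3 → L Φ)
    (hf : IsAutTriple f) :
    ∃ g, Descends N f g ∧ IsAutTriple g ∧ (Function.Injective fun i => lm (g i)) ∧
      Submodule.span Φ (Set.range g) = Submodule.span Φ (Set.range f) := by
  induction hd : index N f using WellFoundedLT.induction generalizing f with
  | _ d ih =>
  by_cases hinj : Function.Injective fun i => lm (f i)
  · exact ⟨f, Relation.ReflTransGen.refl, hf, hinj, rfl⟩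
  · obtain ⟨g, hfg, hlt, hspan⟩ := exists_reduction hN hf hinj
    obtain ⟨k, hk, hk', hk'', hspan'⟩ :=
      ih _ (hd ▸ hlt) g (hf.elementaryTransformation hfg) rfl
    exact ⟨k, Relation.ReflTransGen.head ⟨hfg, hlt⟩ hk, hk', hk'', hspan'.trans hspan⟩

theorem range_lm_subset {f g : Fin 3 → L Φ} (hf : ∀ i, f i ≠ 0) (hg : ∀ i, g i ≠ 0)
    (hinj : Function.Injective fun i => lm (f i))
    (hspan : Submodule.span Φ (Set.range g) ≤ Submodule.span Φ (Set.range f)) :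
    Set.range (fun i => lm (g i)) ⊆ Set.range fun i => lm (f i) := by
  rintro _ ⟨i, rfl⟩
  obtain ⟨c, hc⟩ := (Submodule.mem_span_range_iff_exists_fun Φ).1
    (hspan (Submodule.subset_span ⟨i, rfl⟩))
  have hne : ∃ l, c l ≠ 0 := by
    by_contra! h0
    exact hg i (by rw [← hc]; simp [h0])
  obtain ⟨m, -, hm, -⟩ := exists_lm_sum_eq hf hinj hne
  exact ⟨m, by simp only; rw [← hc, hm]⟩

/-- Two bases of a lattice with strictly decreasing leading words differ by a triangular matrix;
the coefficients on the diagonal are determined by the leading coefficients. -/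
theorem exists_triangular {f g : Fin 3 → L Φ} (hf : ∀ i, f i ≠ 0) (hg : ∀ i, g i ≠ 0)
    (hf' : StrictAnti fun i => lm (f i)) (hlm : ∀ i, lm (g i) = lm (f i))
    (hspan : Submodule.span Φ (Set.range g) ≤ Submodule.span Φ (Set.range f)) (i : Fin 3) :
    ∃ c : Fin 3 → Φ, g i = ∑ j, c j • f j ∧ (∀ j, j < i → c j = 0) ∧
      lc (g i) = c i * lc (f i) := by
  obtain ⟨c, hc⟩ := (Submodule.mem_span_range_iff_exists_fun Φ).1
    (hspan (Submodule.subset_span ⟨i, rfl⟩))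
  have hne : ∃ l, c l ≠ 0 := by
    by_contra! h0
    exact hg i (by rw [← hc]; simp [h0])
  obtain ⟨m, -, hm, hlc, hmax⟩ := exists_lm_sum_eq hf hf'.injective hne
  rw [hc] at hm hlc
  have him : i = m := hf'.injective ((hlm i).symm.trans hm)
  subst him
  refine ⟨c, hc.symm, fun j hj => ?_, hlc⟩
  by_contra hcj
  exact absurd (hf' hj) (not_lt.2 (hmax j hcj))

theorem exists_triangular_isUnit {f g : Fin 3 → L Φ} (hf : ∀ i, f i ≠ 0) (hg : ∀ i, g i ≠ 0)
    (hf' : StrictAnti fun i => lm (f i)) (hg' : StrictAnti fun i => lm (g i))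
    (hspan : Submodule.span Φ (Set.range g) = Submodule.span Φ (Set.range f)) (i : Fin 3) :
    lm (g i) = lm (f i) ∧ ∃ c : Fin 3 → Φ, g i = ∑ j, c j • f j ∧ (∀ j, j < i → c j = 0) ∧
      lc (g i) = c i * lc (f i) ∧ IsUnit (c i) := by
  have hrange : Set.range (fun i => lm (g i)) = Set.range fun i => lm (f i) :=
    Set.Subset.antisymm (range_lm_subset hf hg hf'.injective hspan.le)
      (range_lm_subset hg hf hg'.injective hspan.ge)
  have hlm : ∀ i, lm (g i) = lm (f i) := by
    have h : Set.range (OrderDual.toDual ∘ fun i => lm (g i)) =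
        Set.range (OrderDual.toDual ∘ fun i => lm (f i)) := by
      rw [Set.range_comp, Set.range_comp, hrange]
    exact congrFun ((StrictMono.range_inj hg'.dual_right hf'.dual_right).1 h)
  refine ⟨hlm i, ?_⟩
  obtain ⟨c, hc, hc', hlc⟩ := exists_triangular hf hg hf' hlm hspan.le i
  obtain ⟨d, -, -, hlc'⟩ := exists_triangular hg hf hg' (fun i => (hlm i).symm) hspan.ge i
  refine ⟨c, hc, hc', hlc, IsUnit.of_mul_eq_one (d i) ?_⟩
  refine mul_right_cancel₀ (lc_ne_zero (hf i)) ?_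
  rw [one_mul, mul_comm (c i), mul_assoc, ← hlc, ← hlc']

/-- Bases of the same lattice with strictly decreasing leading words have the same index, and they
are connected by elementary transformations which preserve the index. -/
theorem PreservedBelow.of_span_eq_of_strictAnti {N : Φ → ℕ} (hN : IsEuclideanNorm N)
    {b d : IndexType} (hd : PreservedBelow N b d) {f g : Fin 3 → L Φ}
    (hf : IsAutTriple f) (hg : IsAutTriple g)
    (hf' : StrictAnti fun i => lm (f i)) (hg' : StrictAnti fun i => lm (g i))
    (hspan : Submodule.span Φ (Set.range g) = Submodule.span Φ (Set.range f))
    (hsimple : Simple N b f) (hlt : index N f < d) : Simple N b g := by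
  have key := exists_triangular_isUnit hf.ne_zero hg.ne_zero hf' hg' hspan
  have hsize : ∀ i, size N (g i) = size N (f i) := by
    intro i
    obtain ⟨hlm, c, -, -, hlc, hu⟩ := key i
    rw [size, size, hlm, hlc, norm_unit_mul hN hu (lc_ne_zero (hf.ne_zero i))]
  -- the components are replaced in the order 0, 1, 2, so that those of greater index, which occur
  -- in the expression of the new component, still belong to the old basis
  have replace : ∀ (i : Fin 3) (h : Fin 3 → L Φ), IsAutTriple h → Simple N b h →
      (∀ j, size N (h j) = size N (f j)) → (∀ j, i ≤ j → h j = f j) →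
      IsAutTriple (Function.update h i (g i)) ∧ Simple N b (Function.update h i (g i)) ∧
        ∀ j, size N (Function.update h i (g i) j) = size N (f j) := by
    intro i h haut hs hsz hj
    obtain ⟨-, c, hc, hc', -, hu⟩ := key i
    have hE : ElementaryTransformation h (Function.update h i (g i)) := by
      refine elementaryTransformation_iff.2 ⟨i, c i, ∑ j ∈ Finset.univ.erase i, c j • f j, hu,
        sum_mem fun j hji => ?_, ?_, fun l hl => Function.update_of_ne hl _ _⟩
      · rcases lt_or_gt_of_ne (Finset.ne_of_mem_erase hji) with hlt' | hgt
        · rw [hc' j hlt', zero_smul]; exact zero_mem _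
        · rw [← hj j hgt.le]
          exact SMulMemClass.smul_mem _ (mem_others h (ne_of_gt hgt))
      · rw [Function.update_self, hj i le_rfl, hc,
          Finset.add_sum_erase _ (fun j => c j • f j) (Finset.mem_univ i)]
    refine ⟨haut.elementaryTransformation hE, hd h _ haut hs hE ?_, fun j => ?_⟩
    · rw [index_eq_of_size_eq hsz]; exact hlt
    · by_cases hji : j = i
      · rw [hji, Function.update_self, hsize]
      · rw [Function.update_of_ne hji, hsz]
  obtain ⟨ha₀, hs₀, hz₀⟩ := replace 0 f hf hsimple (fun _ => rfl) fun _ _ => rfl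
  obtain ⟨ha₁, hs₁, hz₁⟩ := replace 1 _ ha₀ hs₀ hz₀ fun j hj =>
    Function.update_of_ne (by rintro rfl; exact absurd hj (by decide)) _ _
  obtain ⟨-, hs₂, -⟩ := replace 2 _ ha₁ hs₁ hz₁ fun j hj => by
    rw [Function.update_of_ne (by rintro rfl; exact absurd hj (by decide)),
      Function.update_of_ne (by rintro rfl; exact absurd hj (by decide))]
  convert hs₂ using 1
  ext1 j
  fin_cases j <;> simp

theorem PreservedBelow.of_span_eq {N : Φ → ℕ} (hN : IsEuclideanNorm N) {b d : IndexType}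
    (hd : PreservedBelow N b d) {f g : Fin 3 → L Φ} (hf : IsAutTriple f) (hg : IsAutTriple g)
    (hspan : Submodule.span Φ (Set.range g) = Submodule.span Φ (Set.range f))
    (hsimple : Simple N b f) (hlt : index N f < d) : Simple N b g := by
  obtain ⟨f', hff', hf', hinjf, hspanf⟩ := exists_reduced hN f hf
  obtain ⟨g', hgg', hg', hinjg, hspang⟩ := exists_reduced hN g hg
  obtain ⟨σ, hσ⟩ := exists_perm_strictAnti hinjf
  obtain ⟨τ, hτ⟩ := exists_perm_strictAnti hinjg
  have hrange : ∀ (h : Fin 3 → L Φ) (ρ : Equiv.Perm (Fin 3)),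
      Set.range (h ∘ ρ) = Set.range h := fun h ρ => ρ.surjective.range_comp h
  have h₁ := hd.of_descends hff' hf hsimple hlt
  have h₂ : Simple N b (g' ∘ τ) :=
    hd.of_span_eq_of_strictAnti hN (hf'.comp_perm σ) (hg'.comp_perm τ) hσ hτ
      (by rw [hrange, hrange, hspang, hspan, hspanf]) (h₁.comp_perm σ)
      (by rw [index_comp_perm]; exact hff'.index_le.trans_lt hlt)
  have h₃ := h₂.comp_perm τ.symm
  have h₄ : (g' ∘ τ) ∘ τ.symm = g' := by
    ext1 j; simp
  rw [h₄] at h₃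
  exact h₃.of_descends hgg'

end Lattice

/-! ### Two reductions of the same triple -/

section Peak

variable {Φ : Type*} [CommRing Φ] [IsDomain Φ]

/-- If a transformation of the `j`-th component does not increase its size and the `i`-th leading
word is greater than the `j`-th and different from the `k`-th, then this transformation does not
involve the `i`-th component. Hence it commutes with transformations of the `i`-th component. -/
theorem exists_commuting {f g₁ g₂ : Fin 3 → L Φ} (hf : IsAutTriple f) {N : Φ → ℕ}
    {i j k : Fin 3} (hji : j ≠ i) (hki : k ≠ i) (hkj : k ≠ j)
    (hall : ∀ l, l = i ∨ l = j ∨ l = k) (hlt : lm (f j) < lm (f i)) (hne : lm (f k) ≠ lm (f i))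
    {α β : Φ} {h₁ h₂ : L Φ} (hα : IsUnit α) (hβ : IsUnit β) (hh₁ : h₁ ∈ others i f)
    (hh₂ : h₂ ∈ others j f) (hi₁ : g₁ i = α • f i + h₁) (hj₁ : ∀ l, l ≠ i → g₁ l = f l)
    (hj₂ : g₂ j = β • f j + h₂) (hi₂ : ∀ l, l ≠ j → g₂ l = f l)
    (hle : size N (g₂ j) ≤ size N (f j)) :
    ElementaryTransformation g₁ (Function.update g₁ j (g₂ j)) ∧
      ElementaryTransformation g₂ (Function.update g₁ j (g₂ j)) := by
  have hlm := lm_le_of_eq_add hj₂ hle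
  rw [others_eq (Ne.symm hji) hkj (fun l => by rcases hall l with h | h | h <;> simp [h])] at hh₂
  obtain ⟨c, d, hcd⟩ := exists_linear_pair_of_lm_ne (hf.ne_zero i) (hf.ne_zero k) hne.symm hh₂
    (le_max_of_le_left (hlm.trans hlt.le))
  have hc : c = 0 := by
    by_contra hc
    have hinj : Function.Injective fun t : Bool => lm (cond t (f i) (f k)) := by
      intro s t hst
      cases s <;> cases t
      · rfl
      · exact absurd hst hne
      · exact absurd hst.symm hne
      · rfl
    obtain ⟨m, -, hm, -, hmax⟩ := exists_lm_sum_eq (f := fun t : Bool => cond t (f i) (f k))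
      (c := fun t : Bool => cond t c d) (fun t => by cases t <;> exact hf.ne_zero _) hinj
      ⟨true, hc⟩
    have hle' : lm (f i) ≤ lm h₂ := by
      have := hmax true hc
      rw [← hm, Fintype.sum_bool] at this
      rwa [hcd]
    exact absurd (hle'.trans hlm) (not_le.2 hlt)
  rw [hc, zero_smul, zero_add] at hcd
  constructor
  · refine elementaryTransformation_iff.2 ⟨j, β, h₂, hβ, ?_, ?_,
      fun l hl => Function.update_of_ne hl _ _⟩
    · rw [hcd, ← hj₁ k hki]
      exact SMulMemClass.smul_mem _ (mem_others g₁ hkj)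
    · rw [Function.update_self, hj₁ j hji, hj₂]
  · refine elementaryTransformation_iff.2 ⟨i, α, h₁, hα, ?_, ?_, fun l hl => ?_⟩
    · rw [others_eq hji hki hall] at hh₁ ⊢
      refine LieSubalgebra.lieSpan_le.2 ?_ hh₁
      have hk : f k ∈ LieSubalgebra.lieSpan Φ (L Φ) {g₂ j, g₂ k} := by
        rw [hi₂ k hkj]; exact LieSubalgebra.subset_lieSpan (by simp)
      rintro _ (rfl | rfl)
      · obtain ⟨u, rfl⟩ := hβ
        have : f j = (↑u⁻¹ : Φ) • (g₂ j - d • f k) := by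
          rw [hj₂, hcd, add_sub_cancel_right, smul_smul, Units.inv_mul, one_smul]
        rw [SetLike.mem_coe, this]
        exact SMulMemClass.smul_mem _ (sub_mem (LieSubalgebra.subset_lieSpan (by simp))
          (SMulMemClass.smul_mem _ hk))
      · exact hk
    · rw [Function.update_of_ne (Ne.symm hji), hi₂ i (Ne.symm hji), hi₁]
    · by_cases hlj : l = j
      · rw [hlj, Function.update_self]
      · rw [Function.update_of_ne hlj, hj₁ l hl, hi₂ l hlj]

/-- A transformation of the `i`-th component which does not increase its size is linear, and so
preserves the span, as soon as one of the other leading words is at least the `i`-th one. -/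
theorem span_eq_of_lm_le {f g : Fin 3 → L Φ} (hf : IsAutTriple f) {N : Φ → ℕ}
    (hN : IsEuclideanNorm N) {i j k : Fin 3} (hji : j ≠ i) (hki : k ≠ i) (hkj : k ≠ j)
    (hall : ∀ l, l = i ∨ l = j ∨ l = k) (hmax : lm (f i) ≤ max (lm (f j)) (lm (f k))) {α : Φ}
    {h : L Φ} (hα : IsUnit α) (hh : h ∈ others i f) (hi : g i = α • f i + h)
    (hl : ∀ l, l ≠ i → g l = f l) (hle : size N (g i) ≤ size N (f i)) :
    Submodule.span Φ (Set.range g) = Submodule.span Φ (Set.range f) := by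
  rw [others_eq hji hki hall] at hh
  obtain ⟨c, d, hcd⟩ := exists_linear_pair hN (hf.pair_independent (Ne.symm hkj)) hh
    ((lm_le_of_eq_add hi hle).trans hmax)
  exact span_range_eq hji hki hα (by rw [hi, hcd]) hl

/-- Elementary transformations preserve simplicity. If `f` is transformed into `g` with an index
not greater than that of `f`, then `g` is compared with a reduction `g₁` of `f`: they are obtained
from each other by a transformation of one component, or they have a common transformation of
smaller index, or they are bases of the same lattice. -/
theorem Simple.elementaryTransformation {N : Φ → ℕ} (hN : IsEuclideanNorm N) {b : IndexType}
    {f g₂ : Fin 3 → L Φ} (hf : IsAutTriple f) (hs : Simple N b f)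
    (hE : ElementaryTransformation f g₂) : Simple N b g₂ := by
  induction hd : index N f using WellFoundedLT.induction generalizing f g₂ with
  | _ d ih =>
  have hd' : PreservedBelow N b (index N f) := fun f' g' hf' hs' hE' hlt =>
    ih _ (hd ▸ hlt) hf' hs' hE' rfl
  rcases lt_or_ge (index N f) (index N g₂) with hlt | hle
  · exact .step hE.symm hlt hs
  cases hs with
  | of_le h => exact .of_le (hle.trans h)
  | @step _ g₁ hE₁ hlt hs₁ =>
  have haut₁ := hf.elementaryTransformation hE₁
  have haut₂ := hf.elementaryTransformation hE
  obtain ⟨i, α, h₁, hα, hh₁, hi₁, hj₁⟩ := elementaryTransformation_iff.1 hE₁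
  obtain ⟨j, β, h₂, hβ, hh₂, hj₂, hi₂⟩ := elementaryTransformation_iff.1 hE
  have hsize₁ := size_lt_of_index_lt i hlt hj₁
  have hsize₂ := size_le_of_index_le j hle hi₂
  by_cases hij : i = j
  · subst hij
    exact hd' _ _ haut₁ hs₁ (elementaryTransformation_of_same hα hβ hh₁ hh₂ hi₁ hj₂ hj₁ hi₂) hlt
  obtain ⟨k, hki, hkj, hall⟩ := exists_third hij
  have hall' : ∀ l, l = j ∨ l = i ∨ l = k := fun l => by
    rcases hall l with h | h | h <;> simp [h]
  -- both transformations at once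
  have join : ∀ z, ElementaryTransformation g₁ z → ElementaryTransformation g₂ z →
      z j = g₂ j → (∀ l, l ≠ j → z l = g₁ l) → Simple N b g₂ := by
    intro z hz₁ hz₂ hzj hzl
    have hzlt : index N z < index N f := by
      refine lt_of_le_of_lt ?_ hlt
      by_contra! hgt
      have := size_lt_of_index_lt (f := z) (g := g₁) j hgt fun l hl => (hzl l hl).symm
      rw [hj₁ j (Ne.symm hij), hzj] at this
      exact absurd hsize₂ (not_le.2 this)
    exact hd' _ _ (haut₁.elementaryTransformation hz₁) (hd' _ _ haut₁ hs₁ hz₁ hlt) hz₂.symm hzlt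
  have lattice : lm (f i) ≤ max (lm (f j)) (lm (f k)) → lm (f j) ≤ max (lm (f i)) (lm (f k)) →
      Simple N b g₂ := by
    intro hm₁ hm₂
    refine hd'.of_span_eq hN haut₁ haut₂ ?_ hs₁ hlt
    rw [span_eq_of_lm_le hf hN (Ne.symm hij) hki hkj hall hm₁ hα hh₁ hi₁ hj₁ hsize₁.le,
      span_eq_of_lm_le hf hN hij hkj hki hall' hm₂ hβ hh₂ hj₂ hi₂ hsize₂]
  rcases lt_trichotomy (lm (f j)) (lm (f i)) with h | h | h
  · by_cases hk : lm (f k) = lm (f i)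
    · exact lattice (le_max_of_le_right hk.ge) (le_max_of_le_left h.le)
    · obtain ⟨hz₁, hz₂⟩ := exists_commuting hf (Ne.symm hij) hki hkj hall h hk hα hβ hh₁ hh₂
        hi₁ hj₁ hj₂ hi₂ hsize₂
      exact join _ hz₁ hz₂ (Function.update_self _ _ _) fun l hl => Function.update_of_ne hl _ _
  · exact lattice (le_max_of_le_left h.ge) (le_max_of_le_left h.le)
  · by_cases hk : lm (f k) = lm (f j)
    · exact lattice (le_max_of_le_left h.le) (le_max_of_le_right hk.ge)
    · obtain ⟨hz₂, hz₁⟩ := exists_commuting hf hij hkj hki hall' h hk hβ hα hh₂ hh₁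
        hj₂ hi₂ hi₁ hj₁ hsize₁.le
      refine join _ hz₁ hz₂ ?_ fun l hl => ?_
      · exact Function.update_of_ne (Ne.symm hij) _ _
      · by_cases hli : l = i
        · rw [hli, Function.update_self]
        · rw [Function.update_of_ne hli, hi₂ l hl, hj₁ l hli]

end Peak

/-! ### Tame automorphisms -/

section Tame

variable {Φ : Type*} [CommRing Φ] [IsDomain Φ]

theorem lm_x (i : Fin 3) : lm (x Φ i) = letter i := by
  have h : regularCoeffs (x Φ i) = Finsupp.single (letter i) 1 :=
    regularCoeffs_wordElement (letter i)
  refine lm_eq_of_coeff (by rw [h, Finsupp.single_eq_same]; exact one_ne_zero) ?_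
  rw [lm_le_iff]
  intro v hv
  rw [h, Finsupp.single_eq_of_ne hv.ne']

theorem lc_x (i : Fin 3) : lc (x Φ i) = 1 := by
  have h : regularCoeffs (x Φ i) = Finsupp.single (letter i) 1 :=
    regularCoeffs_wordElement (letter i)
  rw [lc, lm_x, h, Finsupp.single_eq_same]

theorem letter_lt {i j : Fin 3} (h : i < j) : letter j < letter i :=
  show Word.Lt (.of j) (.of i) from by simpa [Word.Lt] using h

theorem index_x (N : Φ → ℕ) :
    index N (x Φ) = mkIndex (letter 0) (letter 1) (letter 2) (3 * N 1) := by
  have h₀₁ := (letter_lt (show (0 : Fin 3) < 1 by decide)).le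
  have h₁₂ := (letter_lt (show (1 : Fin 3) < 2 by decide)).le
  have h₀₂ := h₁₂.trans h₀₁
  simp only [index, lm_x, lc_x, sortedIndex, max_eq_left h₁₂, max_eq_left h₀₁, min_eq_right h₀₁,
    min_eq_right h₀₂, min_eq_right h₁₂]
  congr 1
  ring

theorem simple_of_mem_tameSubgroup {N : Φ → ℕ} (hN : IsEuclideanNorm N) {φ : Aut Φ}
    (hφ : φ ∈ tameSubgroup Φ) :
    Simple N (mkIndex (letter 0) (letter 1) (letter 2) (3 * N 1)) (components φ) := by
  induction hφ using Subgroup.closure_induction_right with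
  | one => exact .of_le (index_x N).le
  | mul_right φ _ δ hδ ih =>
    exact ih.elementaryTransformation hN ⟨φ, rfl⟩ (elementaryTransformation_mul φ hδ)
  | mul_inv_cancel φ _ δ hδ ih =>
    refine ih.elementaryTransformation hN ⟨φ, rfl⟩ ?_
    have := elementaryTransformation_mul (φ * δ⁻¹) hδ
    rw [inv_mul_cancel_right] at this
    exact this.symm

end Tame

end FreeLieThree

end

theorem proposition1 {Φ : Type*} [CommRing Φ] [IsDomain Φ] (N : Φ → ℕ)
    (hN : FreeLieThree.IsEuclideanNorm N)
    (φ : FreeLieThree.Aut Φ) (hφ : φ ∈ FreeLieThree.tameSubgroup Φ)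
    (hD : FreeLieThree.mkIndex (FreeLieThree.letter 0) (FreeLieThree.letter 1)
      (FreeLieThree.letter 2) (3 * N 1) < FreeLieThree.D N φ) :
    FreeLieThree.ElementarilyDReducible N φ := by
  rcases FreeLieThree.simple_of_mem_tameSubgroup hN hφ with h | ⟨hE, hlt, -⟩
  · exact absurd hD (not_lt.2 h)
  · obtain ⟨ψ, rfl⟩ := FreeLieThree.IsAutTriple.elementaryTransformation ⟨φ, rfl⟩ hE
    exact ⟨ψ, hE, hlt⟩
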